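/- Fix $k\in\{2,3,4,6\}$ and let $\Gamma_k=\mathbb Z^2\rtimes\mathbb Z/k\mathbb Z$, where the generator of $\mathbb Z/k\mathbb Z$ acts on $\mathbb Z^2$ by $\begin{pmatrix}-1&0\\0&-1\end{pmatrix}$, $\begin{pmatrix}0&-1\\1&-1\end{pmatrix}$, $\begin{pmatrix}0&-1\\1&0\end{pmatrix}$, $\begin{pmatrix}0&-1\\1&1\end{pmatrix}$ for $k=2,3,4,6$ respectively. Let $\Lambda(\Gamma_k)=\mathbb Z^2$ be its translation subgroup; elements of $\Gamma_k\setminus\Lambda(\Gamma_k)$ are called rotations. For a subgroup $\Gamma'\le\Gamma_k$ put $\Lambda(\Gamma')=\Gamma'\cap\Lambda(\Gamma_k)$; let $T(\Gamma')=0$ if $\Gamma'$ contains a rotation and $T(\Gamma')=2$ otherwise; and let $\operatorname{rep}(\Gamma')$ be the dimension of the space of homomorphisms $\Gamma'\to\operatorname{Euc}(2)=\mathbb R^2\rtimes O(2)$ that extend to a discrete faithful representation of $\Gamma_k$. A colored graph is a directed multigraph $G$ (self-loops and multiple edges are allowed) whose edges are colored by elements of $\Gamma_k$. For a closed walk $P$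 that crosses the edges $e_1,\dots,e_t$ with colors $\gamma_1,\dots,\gamma_t$ in this order, let $\rho(P)=\gamma_1^{\epsilon_1}\cdots\gamma_t^{\epsilon_t}$ with $\epsilon_i=1$ if $e_i$ is crossed forwards and $\epsilon_i=-1$ otherwise. Let $G_1,\dots,G_c$ be the connected components of $G$ (isolated vertices included), choose a base vertex $b_i$ in each $G_i$, and let $\rho(\pi_1(G_i,b_i))\le\Gamma_k$ be the subgroup of all $\rho(P)$, where $P$ is a closed walk at $b_i$. Put $T(G_i)=T(\rho(\pi_1(G_i,b_i)))$, and let $\operatorname{rep}(G)=\operatorname{rep}(\Lambda(G,B))$, where $\Lambda(G,B)$ is the subgroup generated by the subgroups $\Lambda(\rho(\pi_1(G_i,b_i)))$, $1\le i\le c$. A map-graph is a graph in which every connected component has exactly one cycle (self-loops count as cycles). A colored graph $G$ is a $\Gamma$-$(1,1)$ graph if 1. $G$ consists of a map-graph on all the vertices of $G$ and $\tfrac12\operatorname{rep}(\Lambda(\Gamma_k))$ additional edges; 2. for each connected component $G_i$ of $G$, $\rho(\pi_1(G_i,b_i))$ contains a rotation; and 3. $\operatorname{rep}(G)=\operatorname{rep}(\Lambda(\Gamma_k))$.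 **Proposition.** Let $V$ be a set of $n\ge1$ vertices, and let $K_{\Gamma_k,n}$ be the colored graph on $V$ that has, for all $i,j\in V$ (including $i=j$) and all $\gamma\in\Gamma_k$, exactly one edge from $i$ to $j$ with color $\gamma$. Identify each set of edges of $K_{\Gamma_k,n}$ with the colored graph on $V$ that has exactly these edges. There is a matroid on the edge set of $K_{\Gamma_k,n}$ whose bases are exactly the $\Gamma$-$(1,1)$ graphs on $V$, and the rank of every edge set $G$ in this matroid is $$g(G)=n+\tfrac12\operatorname{rep}(G)-\tfrac12\sum_{i=1}^cT(G_i),$$ where all of this holds for one and the same matroid whichever base vertices are chosen. In particular, $g$ is non-negative, submodular and monotone. -/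

import Mathlib

open scoped MatrixGroups

noncomputable section

namespace Crystal

/-! ### The groups `Γ_k` and the Euclidean group -/

/-- A homomorphism `f` from a group `H` to the `2 × 2` matrices makes `H` act on the column
vectors `Fin 2 → R` (written multiplicatively) by matrix-vector multiplication. -/
def mulVecAut {R H : Type*} [CommRing R] [Group H] (f : H →* Matrix (Fin 2) (Fin 2) R) :
    H →* MulAut (Multiplicative (Fin 2 → R)) where
  toFun h :=
    { toFun := fun v => Multiplicative.ofAdd ((f h).mulVec v.toAdd)
      invFun := fun v => Multiplicative.ofAdd ((f h⁻¹).mulVec v.toAdd)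
      left_inv := fun v => by
        simp only [toAdd_ofAdd, Matrix.mulVec_mulVec, ← map_mul, inv_mul_cancel, map_one,
          Matrix.one_mulVec, ofAdd_toAdd]
      right_inv := fun v => by
        simp only [toAdd_ofAdd, Matrix.mulVec_mulVec, ← map_mul, mul_inv_cancel, map_one,
          Matrix.one_mulVec, ofAdd_toAdd]
      map_mul' := fun v w => by
        simp only [toAdd_mul, Matrix.mulVec_add, ofAdd_add] }
  map_one' := by
    ext1 v
    change Multiplicative.ofAdd ((f 1).mulVec v.toAdd) = v
    simp only [map_one, Matrix.one_mulVec, ofAdd_toAdd]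
  map_mul' a b := by
    ext1 v
    change Multiplicative.ofAdd ((f (a * b)).mulVec v.toAdd) =
      Multiplicative.ofAdd ((f a).mulVec ((f b).mulVec v.toAdd))
    simp only [map_mul, Matrix.mulVec_mulVec]

/-- The integer matrix by which the generator of `ℤ/k` acts on `ℤ²`, for `k = 2, 3, 4, 6`.
(Other values of `k` are never used; they get the identity matrix.) -/
def rotMatrix : ℕ → SL(2, ℤ)
  | 2 => ⟨!![-1, 0; 0, -1], by simp [Matrix.det_fin_two]⟩
  | 3 => ⟨!![0, -1; 1, -1], by simp [Matrix.det_fin_two]⟩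
  | 4 => ⟨!![0, -1; 1, 0], by simp [Matrix.det_fin_two]⟩
  | 6 => ⟨!![0, -1; 1, 1], by simp [Matrix.det_fin_two]⟩
  | _ => 1

theorem rotMatrix_pow : ∀ k : ℕ, rotMatrix k ^ k = 1
  | 0 => pow_zero _
  | 1 => one_pow 1
  | 2 => by decide
  | 3 => by decide
  | 4 => by decide
  | 5 => one_pow 5
  | 6 => by decide
  | n + 7 => one_pow (n + 7)

/-- The homomorphism `ℤ/k → SL(2, ℤ)` sending the generator to `rotMatrix k`. -/
def rotHom (k : ℕ) : Multiplicative (ZMod k) →* SL(2, ℤ) :=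
  AddMonoidHom.toMultiplicativeLeft
    (ZMod.lift k ⟨zmultiplesHom (Additive SL(2, ℤ)) (Additive.ofMul (rotMatrix k)), by
      rw [zmultiplesHom_apply, natCast_zsmul, ← ofMul_pow, rotMatrix_pow, ofMul_one]⟩)

/-- `rotHom k`, with values regarded as plain integer matrices. -/
def rotMatHom (k : ℕ) : Multiplicative (ZMod k) →* Matrix (Fin 2) (Fin 2) ℤ where
  toFun r := (rotHom k r : Matrix (Fin 2) (Fin 2) ℤ)
  map_one' := by rw [map_one, Matrix.SpecialLinearGroup.coe_one]
  map_mul' a b := by rw [map_mul, Matrix.SpecialLinearGroup.coe_mul]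

/-- The crystallographic group `Γ_k = ℤ² ⋊ ℤ/k`. -/
abbrev CrystGroup (k : ℕ) : Type :=
  Multiplicative (Fin 2 → ℤ) ⋊[mulVecAut (rotMatHom k)] Multiplicative (ZMod k)

/-- The Euclidean group `Euc(2) = ℝ² ⋊ O(2)`. -/
abbrev Euc2 : Type :=
  Multiplicative (Fin 2 → ℝ) ⋊[mulVecAut (Matrix.orthogonalGroup (Fin 2) ℝ).subtype]
    Matrix.orthogonalGroup (Fin 2) ℝ

/-- The coordinates of a Euclidean motion: its translation vector and the entries of its
orthogonal matrix. They identify `Euc(2)` with `ℝ² × O(2)`, as a topological space. -/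
def Euc2.coord (g : Euc2) : (Fin 2 → ℝ) × (Fin 2 → Fin 2 → ℝ) :=
  (g.left.toAdd, fun i j => (g.right : Matrix (Fin 2) (Fin 2) ℝ) i j)

/-! ### Representation spaces -/

/-- The subgroup `Λ(Γ_k) = ℤ²` of translations. Elements outside it are called rotations. -/
def translations (k : ℕ) : Subgroup (CrystGroup k) :=
  (SemidirectProduct.inl : Multiplicative (Fin 2 → ℤ) →* CrystGroup k).range

/-- The translation subgroup `Λ(Γ') = Γ' ∩ Λ(Γ_k)` of a subgroup `Γ'` of `Γ_k`. -/
def transSubgroup {k : ℕ} (H : Subgroup (CrystGroup k)) : Subgroup (CrystGroup k) :=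
  H ⊓ translations k

/-- `Γ'` contains a rotation. -/
def HasRotation {k : ℕ} (H : Subgroup (CrystGroup k)) : Prop :=
  ∃ γ ∈ H, γ ∉ translations k

open Classical in
/-- The invariant `T(Γ')`: `0` if `Γ'` contains a rotation and `2` otherwise. -/
def T {k : ℕ} (H : Subgroup (CrystGroup k)) : ℝ :=
  if HasRotation H then 0 else 2

/-- `Rep(Γ_k)`: the discrete faithful representations `Γ_k → Euc(2)`. -/
def Rep (k : ℕ) : Set (CrystGroup k →* Euc2) :=
  {Φ | Function.Injective Φ ∧ DiscreteTopology (Set.range fun γ => (Φ γ).coord)}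

/-- `Rep_{Γ_k}(Γ')`: the representations of `Γ'` that extend to a discrete faithful representation
of `Γ_k`. -/
def restrictedRep {k : ℕ} (H : Subgroup (CrystGroup k)) : Set (H →* Euc2) :=
  {Φ | ∃ Ψ ∈ Rep k, Φ = Ψ.comp H.subtype}

/-- `rep_{Γ_k}(Γ') = dim Rep_{Γ_k}(Γ')`. A finite set `F` of elements of `Γ'` gives finitely many
real coordinates `Φ ↦ (Φ γ)_{γ ∈ F}` on the space of representations; the dimension is the
largest (Hausdorff) dimension of the image of `Rep_{Γ_k}(Γ')` under such coordinates. It is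
attained when `F` generates `Γ'`, for then the coordinates identify `Rep_{Γ_k}(Γ')` with a subset
of a finite-dimensional real vector space. -/
def rep {k : ℕ} (H : Subgroup (CrystGroup k)) : ℝ :=
  (⨆ F : Finset H, dimH ((fun (Φ : H →* Euc2) (γ : F) => (Φ γ).coord) '' restrictedRep H)).toReal

/-! ### Colored graphs -/

/-- A `Γ_k`-colored directed multigraph with vertex set `V` and edge set `E`. -/
structure ColoredGraph (k : ℕ) (V E : Type*) where
  tail : E → V
  head : E → V
  color : E → CrystGroup k

/-- The colored graph `K_{Γ_k}` on `V` with exactly one edge from `i` to `j` (possibly a self-loop)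
of each color `γ`. -/
def completeGraph (k : ℕ) (V : Type*) : ColoredGraph k V (V × V × CrystGroup k) where
  tail e := e.1
  head e := e.2.1
  color e := e.2.2

namespace ColoredGraph

variable {k : ℕ} {V E : Type*} (G : ColoredGraph k V E)

/-- The subgraph with all the vertices and with edge set `S`. -/
def restrict (S : Set E) : ColoredGraph k V S where
  tail e := G.tail e
  head e := G.head e
  color e := G.color e

/-- The vertex at which a step starts. A step crosses an edge forwards (`(e, true)`) or backwards
(`(e, false)`). -/
def start (d : E × Bool) : V := if d.2 then G.tail d.1 else G.head d.1

/-- The vertex at which a step ends. -/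
def finish (d : E × Bool) : V := if d.2 then G.head d.1 else G.tail d.1

/-- The list of steps is a walk from `u` to `v`. -/
def IsWalk : V → V → List (E × Bool) → Prop
  | u, v, [] => u = v
  | u, v, d :: l => G.start d = u ∧ IsWalk (G.finish d) v l

/-- The map `ρ`: the ordered product of the colors of the edges along a walk, inverted on the edges
that are crossed backwards. -/
def rho (l : List (E × Bool)) : CrystGroup k :=
  (l.map fun d => if d.2 then G.color d.1 else (G.color d.1)⁻¹).prod

/-- The walk `l` traversed in the opposite direction. -/
def reverse (l : List (E × Bool)) : List (E × Bool) :=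
  (l.map fun d => (d.1, !d.2)).reverse

variable {G}

theorem IsWalk.append {u v w : V} {l l' : List (E × Bool)} (h : G.IsWalk u v l)
    (h' : G.IsWalk v w l') : G.IsWalk u w (l ++ l') := by
  induction l generalizing u with
  | nil => cases h; exact h'
  | cons d l ih => exact ⟨h.1, ih h.2⟩

theorem IsWalk.reverse {u v : V} {l : List (E × Bool)} (h : G.IsWalk u v l) :
    G.IsWalk v u (reverse l) := by
  induction l generalizing u with
  | nil => exact Eq.symm h
  | cons d l ih =>
    have h2 : G.IsWalk (G.finish d) u [(d.1, !d.2)] := by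
      refine ⟨?_, ?_⟩
      · cases hd : d.2 <;> simp [start, finish, hd]
      · have := h.1
        cases hd : d.2 <;> simp_all [start, finish, IsWalk]
    have := (ih h.2).append h2
    simpa [ColoredGraph.reverse] using this

theorem rho_append (l l' : List (E × Bool)) : G.rho (l ++ l') = G.rho l * G.rho l' := by
  simp [rho]

theorem rho_reverse (l : List (E × Bool)) : G.rho (reverse l) = (G.rho l)⁻¹ := by
  induction l with
  | nil => simp [rho, reverse]
  | cons d l ih =>
    have h1 : reverse (d :: l) = reverse l ++ [(d.1, !d.2)] := by simp [reverse]
    have h2 : G.rho (d :: l) = G.rho [d] * G.rho l := G.rho_append [d] l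
    have h3 : G.rho [(d.1, !d.2)] = (G.rho [d])⁻¹ := by
      cases hd : d.2 <;> simp [rho, hd]
    rw [h1, rho_append, ih, h2, h3, mul_inv_rev]

variable (G)

/-- The subgroup `ρ(π₁(G, b))` of `Γ_k`: the `ρ`-images of the closed walks at `b`. -/
def rhoImage (b : V) : Subgroup (CrystGroup k) where
  carrier := {γ | ∃ l, G.IsWalk b b l ∧ G.rho l = γ}
  one_mem' := ⟨[], rfl, by simp [rho]⟩
  mul_mem' := by
    rintro _ _ ⟨l, hl, rfl⟩ ⟨l', hl', rfl⟩
    exact ⟨l ++ l', hl.append hl', G.rho_append l l'⟩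
  inv_mem' := by
    rintro _ ⟨l, hl, rfl⟩
    exact ⟨reverse l, hl.reverse, G.rho_reverse l⟩

/-- Two vertices are equivalent if they are joined by a walk. -/
def reachable : Setoid V where
  r u v := ∃ l, G.IsWalk u v l
  iseqv :=
    { refl := fun _ => ⟨[], rfl⟩
      symm := fun ⟨l, hl⟩ => ⟨reverse l, hl.reverse⟩
      trans := fun ⟨l, hl⟩ ⟨l', hl'⟩ => ⟨l ++ l', hl.append hl'⟩ }

/-- The connected components of `G` (an isolated vertex is a component). -/
def Component : Type _ := Quotient G.reachable

/-- The connected component of a vertex. -/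
def component (v : V) : G.Component := Quotient.mk G.reachable v

/-- A choice of base vertices, one in each connected component. -/
structure BaseVertices where
  vertex : G.Component → V
  component_vertex : ∀ c, G.component (vertex c) = c

/-- `C` is the edge set of a cycle in the component `c`: of a nonempty closed walk in `c` that
repeats no edge and no vertex (self-loops and pairs of parallel edges are cycles). -/
def IsCycleIn (c : G.Component) (C : Set E) : Prop :=
  ∃ (v : V) (l : List (E × Bool)), G.component v = c ∧ G.IsWalk v v l ∧ l ≠ [] ∧
    (l.map Prod.fst).Nodup ∧ (l.map G.start).Nodup ∧ C = {e | e ∈ l.map Prod.fst}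

/-- A map-graph: every connected component has exactly one cycle. -/
def IsMapGraph : Prop := ∀ c : G.Component, ∃! C : Set E, G.IsCycleIn c C

variable {G}

/-- `Λ(G, B)`: the subgroup generated by the translation subgroups of the `ρ`-images of the
components. -/
def transGroup (B : G.BaseVertices) : Subgroup (CrystGroup k) :=
  ⨆ c : G.Component, transSubgroup (G.rhoImage (B.vertex c))

/-- `G` is a `Γ`-`(1,1)` graph (with respect to the base vertices `B`): it is a spanning map-graph
with edge set `S` plus `½ rep(Λ(Γ_k))` more edges, the `ρ`-image of every component contains a
rotation, and `rep(Λ(G, B)) = rep(Λ(Γ_k))`. -/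
def IsGamma11 (B : G.BaseVertices) : Prop :=
  (∃ S : Set E, (G.restrict S).IsMapGraph ∧ Sᶜ.Finite ∧
      (Sᶜ.ncard : ℝ) = rep (translations k) / 2) ∧
    (∀ c : G.Component, HasRotation (G.rhoImage (B.vertex c))) ∧
    rep (transGroup B) = rep (translations k)

/-- The function `g(G) = n + ½ rep(G) - ½ ∑ T(G_i)`, where `rep(G) = rep(Λ(G, B))` and
`T(G_i) = T(ρ(π₁(G_i, b_i)))`. The sum is finite since `V` is. -/
def g [Fintype V] (B : G.BaseVertices) : ℝ :=
  Fintype.card V + rep (transGroup B) / 2 - (∑ᶠ c : G.Component, T (G.rhoImage (B.vertex c))) / 2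

end ColoredGraph

end Crystal

end

noncomputable section

namespace Crystal

namespace ColoredGraph

variable {k : ℕ} {V E : Type*} {G : ColoredGraph k V E}

/-! ### Walks and cycles -/

/-! The matroid is linear over ℂ. Let d = ½ rep(Λ(Γ_k)), so d = 2 for k = 2 and d = 1 otherwise.
There are a faithful character χ of ℤ/k and a map φ : ℤ² → ℂ^d with spanning image that is
equivariant for χ (`AffineModel`). Each linear functional L on ℂ^d makes Γ_k act affinely on ℂ,
rotations through χ and a translation t by adding L(φ t). An edge from i to j with color γ imposes
x_i = γ · x_j, a linear condition on the pair (x, L); its coefficient vector is `row` in ℂ^V × ℂ^d.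

Rank (`finrank_span_row`): the rank of the rows is n + d minus the dimension of the solution space.
In a solution, L must vanish on the translations in Λ(G, B). Conversely, for such an L every group
ρ(π₁(G_i, b_i)) has a fixed point (`exists_fixed`), where the base vertex can be placed; walks then
determine all other positions. The fixed point is unique if the group contains a rotation and
arbitrary in ℂ otherwise. Hence the rank is n + dim span φ(Λ(G, B)) minus the number of components
without rotation.

Dimension (`rep_eq`): rep(H) = 2 dim span φ(H) for every translation subgroup H. Discrete faithful
representations send translations to translations (`mat_eq_one_of_mem_translations`), and up to
complex conjugation their lattices are t ↦ φ(t) · y with y in ℂ^d; conversely an open set of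
parameters y occurs. With this the rank becomes g.

Bases (`isGamma11_iff`): a Γ-(1,1) graph has n + d edges and g = n + d, so its rows form a basis.
Conversely, if the rows form a basis, their projections to ℂ^V span, and edges whose projections
form a basis of ℂ^V make up a spanning map-graph (`isMapGraph_of_gainRow`). -/

theorem IsWalk.split {u v : V} {l l' : List (E × Bool)} (h : G.IsWalk u v (l ++ l')) :
    ∃ w, G.IsWalk u w l ∧ G.IsWalk w v l' := by
  induction l generalizing u with
  | nil => exact ⟨u, rfl, h⟩
  | cons d l ih =>
    obtain ⟨w, hw, hw'⟩ := ih h.2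
    exact ⟨w, ⟨h.1, hw⟩, hw'⟩

theorem component_eq_iff {u v : V} :
    G.component u = G.component v ↔ ∃ l, G.IsWalk u v l :=
  Quotient.eq (r := G.reachable)

theorem isWalk_step (d : E × Bool) : G.IsWalk (G.start d) (G.finish d) [d] := ⟨rfl, rfl⟩

theorem component_start_eq_finish (d : E × Bool) :
    G.component (G.start d) = G.component (G.finish d) :=
  component_eq_iff.2 ⟨[d], isWalk_step d⟩

theorem component_tail_eq_head (e : E) : G.component (G.tail e) = G.component (G.head e) :=
  component_start_eq_finish (G := G) (e, true)

theorem component_start (d : E × Bool) : G.component (G.start d) = G.component (G.tail d.1) := by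
  obtain ⟨e, _ | _⟩ := d
  · exact (component_tail_eq_head e).symm
  · rfl

theorem IsWalk.component_tail {u v : V} {l : List (E × Bool)} (h : G.IsWalk u v l) :
    ∀ d ∈ l, G.component (G.tail d.1) = G.component u := by
  induction l generalizing u with
  | nil => simp
  | cons d l ih =>
    intro d' hd'
    rcases List.mem_cons.1 hd' with rfl | hd'
    · rw [← h.1, component_start]
    · rw [ih h.2 d' hd', ← h.1, component_start_eq_finish]

theorem IsCycleIn.component_tail {c : G.Component} {C : Set E} (h : G.IsCycleIn c C) {e : E}
    (he : e ∈ C) : G.component (G.tail e) = c := by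
  obtain ⟨v, l, rfl, hl, -, -, -, rfl⟩ := h
  obtain ⟨d, hd, rfl⟩ := List.mem_map.1 he
  exact hl.component_tail d hd

theorem IsCycleIn.nonempty {c : G.Component} {C : Set E} (h : G.IsCycleIn c C) : C.Nonempty := by
  obtain ⟨v, l, -, -, hl, -, -, rfl⟩ := h
  obtain ⟨d, l, rfl⟩ := List.exists_cons_of_ne_nil hl
  exact ⟨d.1, by simp⟩

theorem IsWalk.finish_mem {u v : V} {l : List (E × Bool)} (h : G.IsWalk u v l) :
    ∀ d ∈ l, G.finish d ∈ l.map G.start ∨ G.finish d = v := by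
  induction l generalizing u with
  | nil => simp
  | cons d l ih =>
    intro d' hd'
    rcases List.mem_cons.1 hd' with rfl | hd'
    · cases l with
      | nil => exact Or.inr h.2
      | cons d'' l => exact Or.inl (by simp [h.2.1])
    · rcases ih h.2 d' hd' with h' | h'
      · exact Or.inl (by simp only [List.map_cons, List.mem_cons]; exact Or.inr h')
      · exact Or.inr h'

/-- Every walk contains a path with the same ends. -/
theorem IsWalk.exists_path {u v : V} {l : List (E × Bool)} (h : G.IsWalk u v l) :
    ∃ q, G.IsWalk u v q ∧ q ⊆ l ∧ (q.map Prod.fst).Nodup ∧ (q.map G.start).Nodup ∧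
      v ∉ q.map G.start := by
  induction l generalizing u with
  | nil => exact ⟨[], h, by simp⟩
  | cons d l ih =>
    obtain ⟨q, hq, hql, hqe, hqs, hqv⟩ := ih h.2
    by_cases huv : u = v
    · exact ⟨[], huv, by simp⟩
    -- If the path already visits `u`, the detour before that visit is cut off; otherwise the first
    -- step is put in front.
    by_cases hu : u ∈ q.map G.start
    · obtain ⟨d', hd', rfl⟩ := List.mem_map.1 hu
      obtain ⟨q₁, q₂, rfl⟩ := List.append_of_mem hd'
      obtain ⟨w, -, hw⟩ := hq.split
      refine ⟨d' :: q₂, ⟨rfl, hw.2⟩, ?_, ?_, ?_, ?_⟩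
      · exact fun x hx => List.mem_cons_of_mem _ (hql (List.mem_append_right _ hx))
      · rw [List.map_append] at hqe
        exact hqe.of_append_right
      · rw [List.map_append] at hqs
        exact hqs.of_append_right
      · rw [List.map_append] at hqv
        exact fun hv => hqv (List.mem_append_right _ hv)
    · refine ⟨d :: q, ⟨h.1, hq⟩, ?_, ?_, ?_, ?_⟩
      · exact List.cons_subset_cons _ hql
      · refine List.nodup_cons.2 ⟨fun hd => ?_, hqe⟩
        -- An edge of the path equal to the new one has `u` as an end, so the path would visit `u`
        -- or `u` would be its last vertex.
        obtain ⟨d', hd', hdd⟩ := List.mem_map.1 hd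
        have : G.start d' = u ∨ G.finish d' = u := by
          have h1 := h.1
          obtain ⟨e, _ | _⟩ := d <;> obtain ⟨e', _ | _⟩ := d' <;>
            simp_all [start, finish]
        rcases this with h1 | h1
        · exact hu (List.mem_map.2 ⟨d', hd', h1⟩)
        · rcases hq.finish_mem d' hd' with h2 | h2
          · exact hu (h1 ▸ h2)
          · exact huv (h1.symm.trans h2)
      · refine List.nodup_cons.2 ⟨?_, hqs⟩
        rw [h.1]
        exact hu
      · rw [List.map_cons, List.mem_cons, not_or, h.1]
        exact ⟨fun h' => huv h'.symm, hqv⟩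

/-! ### Incidence rows and cycles -/

section Rows

variable [DecidableEq V]

/-- The row of an edge in the incidence matrix of a graph. -/
def incRow (G : ColoredGraph k V E) (e : E) : V → ℂ :=
  Pi.single (G.tail e) 1 - Pi.single (G.head e) 1

/-- The rows of the edges along a walk, with signs, form a telescoping sum. -/
theorem single_sub_single_mem_span {u v : V} {l : List (E × Bool)} (h : G.IsWalk u v l) {A : Set E}
    (hA : ∀ d ∈ l, d.1 ∈ A) :
    Pi.single u 1 - Pi.single v 1 ∈ Submodule.span ℂ (G.incRow '' A) := by
  induction l generalizing u with
  | nil => cases h; simp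
  | cons d l ih =>
    have h1 := ih h.2 fun d hd => hA d (List.mem_cons_of_mem _ hd)
    have h2 : (Pi.single (G.start d) 1 - Pi.single (G.finish d) 1 : V → ℂ) ∈
        Submodule.span ℂ (G.incRow '' A) := by
      have h3 : G.incRow d.1 ∈ Submodule.span ℂ (G.incRow '' A) :=
        Submodule.subset_span ⟨_, hA d (by simp), rfl⟩
      obtain ⟨e, _ | _⟩ := d
      · have := Submodule.neg_mem _ h3
        simpa [incRow, start, finish] using this
      · simpa [incRow, start, finish] using h3
    rw [← h.1]
    simpa using Submodule.add_mem _ h2 h1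

/-- The rest of the cycle is a walk between the ends of `e` that avoids `e`. -/
theorem IsCycleIn.incRow_mem_span {c : G.Component} {C : Set E} (h : G.IsCycleIn c C) {e : E}
    (he : e ∈ C) : G.incRow e ∈ Submodule.span ℂ (G.incRow '' (C \ {e})) := by
  obtain ⟨v, l, -, hl, -, hle, -, rfl⟩ := h
  obtain ⟨d, hd, rfl⟩ := List.mem_map.1 he
  obtain ⟨l₁, l₂, rfl⟩ := List.append_of_mem hd
  obtain ⟨w, hw, hw'⟩ := hl.split
  have hne : ∀ d' ∈ l₁ ++ l₂, d'.1 ≠ d.1 := by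
    intro d' hd' h'
    have : (d.1 :: ((l₁ ++ l₂).map Prod.fst)).Nodup := by
      refine (List.Perm.nodup_iff ?_).1 hle
      simp only [List.map_append, List.map_cons]
      exact List.perm_middle
    exact (List.nodup_cons.1 this).1 (List.mem_map.2 ⟨d', hd', h'⟩)
  have hmem : ∀ d' ∈ l₁ ++ l₂, d'.1 ∈
      {e | e ∈ (l₁ ++ d :: l₂).map Prod.fst} \ {d.1} := by
    intro d' hd'
    refine ⟨List.mem_map.2 ⟨d', ?_, rfl⟩, hne d' hd'⟩
    rcases List.mem_append.1 hd' with h' | h' <;> simp [h']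
  have hA := single_sub_single_mem_span (hw'.2.append hw)
    (A := {e | e ∈ (l₁ ++ d :: l₂).map Prod.fst} \ {d.1})
    fun d' hd' => hmem d' (by rw [List.mem_append] at hd' ⊢; exact hd'.symm)
  rw [← hw'.1] at hA
  obtain ⟨e, _ | _⟩ := d
  · exact hA
  · have := Submodule.neg_mem _ hA
    rw [neg_sub] at this
    exact this

/-- The indicator of the vertices joined to the tail of `e` within `A` is a functional that kills
the rows of `A`, hence that of `e`. So the head of `e` is joined to the tail within `A`, and a path
between them closes up with `e`. -/
theorem exists_isCycleIn_of_incRow_mem_span [Fintype V] {A : Set E} {e : E} (he : e ∉ A)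
    (h : G.incRow e ∈ Submodule.span ℂ (G.incRow '' A)) :
    ∃ C, G.IsCycleIn (G.component (G.tail e)) C ∧ e ∈ C ∧ C ⊆ insert e A := by
  classical
  let P : V → Prop := fun v => ∃ l, G.IsWalk v (G.tail e) l ∧ ∀ d ∈ l, d.1 ∈ A
  have hP : ∀ a ∈ A, P (G.tail a) ↔ P (G.head a) := by
    refine fun a ha => ⟨fun ⟨l, hl, hlA⟩ => ⟨(a, false) :: l, ⟨rfl, hl⟩, ?_⟩,
      fun ⟨l, hl, hlA⟩ => ⟨(a, true) :: l, ⟨rfl, hl⟩, ?_⟩⟩ <;>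
    · intro d hd
      rcases List.mem_cons.1 hd with rfl | hd
      · exact ha
      · exact hlA d hd
  let x : (V → ℂ) →ₗ[ℂ] ℂ := Fintype.linearCombination ℂ fun v => if P v then (1 : ℂ) else 0
  have hx : ∀ v, x (Pi.single v 1) = if P v then (1 : ℂ) else 0 := fun v => by
    simp [x, Fintype.linearCombination_apply_single]
  have h0 : x (G.incRow e) = 0 := by
    have : Submodule.span ℂ (G.incRow '' A) ≤ LinearMap.ker x := by
      rw [Submodule.span_le]
      rintro _ ⟨a, ha, rfl⟩
      simp [incRow, hx, hP a ha]
    exact this h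
  have ht : P (G.tail e) := ⟨[], rfl, by simp⟩
  have hh : P (G.head e) := by
    by_contra hh
    simp [incRow, hx, ht, hh] at h0
  obtain ⟨l, hl, hlA⟩ := hh
  obtain ⟨q, hq, hql, hqe, hqs, hqv⟩ := hl.exists_path
  have hqA : ∀ f ∈ q.map Prod.fst, f ∈ A := by
    intro f hf
    obtain ⟨d, hd, rfl⟩ := List.mem_map.1 hf
    exact hlA d (hql hd)
  refine ⟨_, ⟨G.tail e, (e, true) :: q, rfl, ⟨rfl, hq⟩, by simp, ?_, ?_, rfl⟩, ?_, ?_⟩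
  · exact List.nodup_cons.2 ⟨fun h' => he (hqA _ h'), hqe⟩
  · exact List.nodup_cons.2 ⟨hqv, hqs⟩
  · exact List.mem_cons_self ..
  · intro f hf
    rcases List.mem_cons.1 hf with rfl | hf
    · exact Or.inl rfl
    · exact Or.inr (hqA f hf)

/-! ### Counting the edges of a map-graph -/

instance [Finite V] : Finite G.Component := Quotient.finite _

/-- The annihilator of the span of a family of vectors has complementary dimension. -/
theorem finrank_span_range_add {M ι : Type*} [AddCommGroup M] [Module ℂ M]
    [FiniteDimensional ℂ M] (f : ι → M) (S : Submodule ℂ (Module.Dual ℂ M))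
    (hS : ∀ l, l ∈ S ↔ ∀ i, l (f i) = 0) :
    Module.finrank ℂ (Submodule.span ℂ (Set.range f)) + Module.finrank ℂ S =
      Module.finrank ℂ M := by
  rw [← Subspace.finrank_add_finrank_dualAnnihilator_eq (Submodule.span ℂ (Set.range f))]
  have : S = (Submodule.span ℂ (Set.range f)).dualAnnihilator := by
    ext l
    rw [hS, Submodule.mem_dualAnnihilator]
    constructor
    · intro h w hw
      have : Submodule.span ℂ (Set.range f) ≤ LinearMap.ker l := by
        rw [Submodule.span_le]
        rintro _ ⟨i, rfl⟩
        exact h i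
      exact this hw
    · exact fun h i => h _ (Submodule.subset_span ⟨i, rfl⟩)
  rw [this]

/-- The functionals that kill all incidence rows are the functions constant on components. -/
theorem finrank_span_incRow_add_card [Fintype V] (G : ColoredGraph k V E) :
    Module.finrank ℂ (Submodule.span ℂ (Set.range G.incRow)) + Nat.card G.Component =
      Fintype.card V := by
  classical
  have : Fintype G.Component := Fintype.ofFinite _
  let pull : (G.Component → ℂ) →ₗ[ℂ] Module.Dual ℂ (V → ℂ) :=
    { toFun := fun z => Fintype.linearCombination ℂ fun v => z (G.component v)
      map_add' := fun z w => by
        ext v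
        simp
      map_smul' := fun a z => by
        ext v
        simp }
  have hpull : ∀ z v, pull z (Pi.single v 1) = z (G.component v) := fun z v => by
    simp [pull, Fintype.linearCombination_apply_single]
  have hinj : Function.Injective pull := by
    intro z w h
    ext c
    obtain ⟨v, rfl⟩ := Quotient.exists_rep c
    have := congrArg (fun l => l (Pi.single v 1)) h
    simp only [hpull] at this
    exact this
  have h := finrank_span_range_add G.incRow (LinearMap.range pull) (fun l => ⟨?_, fun h => ?_⟩)
  · rw [LinearMap.finrank_range_of_inj hinj, Module.finrank_fintype_fun_eq_card,
      Module.finrank_fintype_fun_eq_card] at h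
    rw [Nat.card_eq_fintype_card]
    exact h
  · rintro ⟨z, rfl⟩ e
    simp [incRow, hpull, component_tail_eq_head]
  · have hw : ∀ (p : List (E × Bool)) (u v : V), G.IsWalk u v p →
        l (Pi.single u 1) = l (Pi.single v 1) := by
      intro p u v hp
      have h1 := single_sub_single_mem_span hp (A := Set.univ) (by simp)
      have h2 : Submodule.span ℂ (G.incRow '' Set.univ) ≤ LinearMap.ker l := by
        rw [Submodule.span_le]
        rintro _ ⟨e, -, rfl⟩
        exact h e
      have := h2 h1
      rw [LinearMap.mem_ker, map_sub, sub_eq_zero] at this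
      exact this
    refine ⟨Quotient.lift (fun v => l (Pi.single v 1)) fun u v ⟨p, hp⟩ => hw p u v hp, ?_⟩
    refine LinearMap.pi_ext' fun v => LinearMap.ext_ring ?_
    exact hpull _ v

/-- Removing one edge of each cycle leaves a spanning forest, whose independent rows number n minus
the number of components; one edge per component was removed. -/
theorem IsMapGraph.card_eq [Fintype V] (h : G.IsMapGraph) :
    Finite E ∧ Nat.card E = Fintype.card V := by
  choose C hC hCu using h
  choose e he using fun c => (hC c).nonempty
  have hec : ∀ c, G.component (G.tail (e c)) = c := fun c => (hC c).component_tail (he c)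
  have hinj : Function.Injective e := fun c c' h => by rw [← hec c, h, hec]
  let R : Set E := Set.range e
  have hR : R.Finite := Set.finite_range e
  have hspan : Submodule.span ℂ (G.incRow '' Rᶜ) = Submodule.span ℂ (Set.range G.incRow) := by
    refine le_antisymm (Submodule.span_mono (Set.image_subset_range _ _)) (Submodule.span_le.2 ?_)
    rintro _ ⟨a, rfl⟩
    by_cases ha : a ∈ R
    · obtain ⟨c, rfl⟩ := ha
      refine Submodule.span_mono (Set.image_mono ?_) ((hC c).incRow_mem_span (he c))
      rintro a ⟨ha, hac⟩ ⟨c', rfl⟩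
      have := (hC c).component_tail ha
      rw [hec] at this
      exact hac (by rw [this]; rfl)
    · exact Submodule.subset_span ⟨a, ha, rfl⟩
  have hli : LinearIndependent ℂ (fun a : ↥(Rᶜ) => G.incRow a) := by
    change LinearIndepOn ℂ G.incRow Rᶜ
    rw [linearIndepOn_iff_notMem_span]
    intro a ha hmem
    -- A dependence among the remaining edges would give a cycle within them, but the only cycle of
    -- its component has lost an edge.
    obtain ⟨D, hD, haD, hDR⟩ := exists_isCycleIn_of_incRow_mem_span (by simp) hmem
    have hDe := he (G.component (G.tail a))
    rw [← hCu _ D hD] at hDe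
    have := hDR hDe
    rw [Set.insert_sdiff_singleton, Set.insert_eq_of_mem ha] at this
    exact this ⟨_, rfl⟩
  have hfin : Finite ↥(Rᶜ) := hli.finite
  have hE : Finite E := Set.finite_univ_iff.1 (by
    rw [← Set.union_compl_self R]
    exact hR.union hfin)
  refine ⟨hE, ?_⟩
  have : Fintype ↥(Rᶜ) := Fintype.ofFinite _
  have h1 := finrank_span_eq_card hli
  have h2 : Set.range (fun a : ↥(Rᶜ) => G.incRow a) = G.incRow '' Rᶜ := by
    rw [Set.image_eq_range]
  rw [h2, hspan] at h1
  have h3 := G.finrank_span_incRow_add_card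
  have h4 := Set.ncard_add_ncard_compl R
  have h5 : R.ncard = Nat.card G.Component := by
    rw [← Nat.card_coe_set_eq]
    exact Nat.card_range_of_injective hinj
  rw [h1, ← Nat.card_eq_fintype_card, Nat.card_coe_set_eq] at h3
  omega

/-! ### Gain graphs whose rows form a basis -/

/-- The row of an edge in the incidence matrix of a gain graph. -/
def gainRow (G : ColoredGraph k V E) (a : E → ℂ) (e : E) : V → ℂ :=
  Pi.single (G.tail e) 1 - a e • Pi.single (G.head e) 1

theorem gainRow_one : G.gainRow (fun _ => 1) = G.incRow := by
  ext e
  simp [gainRow, incRow]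

theorem gainRow_apply_of_component_ne (a : E → ℂ) {e : E} {v : V}
    (h : G.component v ≠ G.component (G.tail e)) : G.gainRow a e v = 0 := by
  have h1 : v ≠ G.tail e := fun h' => h (by rw [h'])
  have h2 : v ≠ G.head e := fun h' => h (by rw [h', component_tail_eq_head])
  simp [gainRow, h1, h2]

/-- Restriction of functions to the vertices of a component. -/
def restrictTo (c : G.Component) : (V → ℂ) →ₗ[ℂ] ({v // G.component v = c} → ℂ) :=
  LinearMap.funLeft ℂ ℂ Subtype.val

theorem restrictTo_gainRow_of_ne (a : E → ℂ) {c : G.Component} {e : E}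
    (h : G.component (G.tail e) ≠ c) : restrictTo c (G.gainRow a e) = 0 := by
  ext ⟨v, rfl⟩
  exact gainRow_apply_of_component_ne a h.symm

/-- Rows of edges in `c` vanish outside `c`, so restriction to `c` is injective on their span. -/
theorem linearIndependent_restrictTo_gainRow (a : E → ℂ) (c : G.Component)
    (h : LinearIndepOn ℂ (G.gainRow a) {e | G.component (G.tail e) = c}) :
    LinearIndependent ℂ
      fun e : {e // G.component (G.tail e) = c} => restrictTo c (G.gainRow a e) := by
  refine LinearIndependent.map_injOn (v := fun e : {e // G.component (G.tail e) = c} =>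
    G.gainRow a e) h (restrictTo c) ?_
  let S : Submodule ℂ (V → ℂ) :=
    { carrier := {x | ∀ v, G.component v ≠ c → x v = 0}
      add_mem' := fun hx hy v hv => by simp [hx v hv, hy v hv]
      zero_mem' := fun v _ => rfl
      smul_mem' := fun t x hx v hv => by simp [hx v hv] }
  have hS : Submodule.span ℂ (Set.range fun e : {e // G.component (G.tail e) = c} =>
      G.gainRow a e) ≤ S := by
    rw [Submodule.span_le]
    rintro _ ⟨⟨e, rfl⟩, rfl⟩ v hv
    exact gainRow_apply_of_component_ne a hv
  intro x hx y hy hxy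
  ext v
  by_cases hv : G.component v = c
  · exact congrFun hxy ⟨v, hv⟩
  · rw [hS hx v hv, hS hy v hv]

/-- If the rows of a gain graph form a basis, the graph is a map-graph. -/
theorem isMapGraph_of_gainRow [Fintype V] (a : E → ℂ) (hli : LinearIndependent ℂ (G.gainRow a))
    (hsp : Submodule.span ℂ (Set.range (G.gainRow a)) = ⊤) : G.IsMapGraph := by
  classical
  intro c
  have hE : Finite E := hli.finite
  have : Fintype E := Fintype.ofFinite _
  let F : Set E := {e | G.component (G.tail e) = c}
  let U := {v // G.component v = c}
  -- Independence and spanning show that each component has as many edges as vertices. From here on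
  -- only these counts matter, not the gains.
  have hle : Fintype.card F ≤ Fintype.card U := by
    have := (linearIndependent_restrictTo_gainRow a c (hli.linearIndepOn _)).fintype_card_le_finrank
    rwa [Module.finrank_fintype_fun_eq_card] at this
  have hge : Fintype.card U ≤ Fintype.card F := by
    have h1 : (⊤ : Submodule ℂ (U → ℂ)) ≤
        Submodule.span ℂ (Set.range fun e : F => restrictTo c (G.gainRow a e)) := by
      have h2 : Submodule.map (restrictTo c) (⊤ : Submodule ℂ (V → ℂ)) = ⊤ := by
        rw [Submodule.map_top, LinearMap.range_eq_top]
        exact LinearMap.funLeft_surjective_of_injective ℂ ℂ _ Subtype.val_injective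
      rw [← h2, ← hsp, Submodule.map_span, Submodule.span_le]
      rintro _ ⟨_, ⟨e, rfl⟩, rfl⟩
      by_cases he : G.component (G.tail e) = c
      · exact Submodule.subset_span ⟨⟨e, he⟩, rfl⟩
      · rw [restrictTo_gainRow_of_ne a he]
        exact Submodule.zero_mem _
    have h3 := finrank_range_le_card (R := ℂ) fun e : F => restrictTo c (G.gainRow a e)
    rw [Set.finrank, top_le_iff.1 h1, finrank_top, Module.finrank_fintype_fun_eq_card] at h3
    exact h3
  have hFc : ∀ {C}, G.IsCycleIn c C → C ⊆ F := fun hC e he => hC.component_tail he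
  obtain ⟨C, hC⟩ : ∃ C, G.IsCycleIn c C := by
    -- Without a cycle the incidence rows of the component would be independent. They lie in the
    -- hyperplane of vectors with coordinate sum 0, so there would be fewer edges than vertices.
    by_contra hno
    have h1 : LinearIndepOn ℂ (G.gainRow fun _ => 1) F := by
      rw [gainRow_one, linearIndepOn_iff_notMem_span]
      intro e he hmem
      obtain ⟨C, hC, -⟩ := exists_isCycleIn_of_incRow_mem_span (by simp) hmem
      rw [show G.component (G.tail e) = c from he] at hC
      exact hno ⟨C, hC⟩
    have h2 := finrank_span_eq_card (linearIndependent_restrictTo_gainRow _ c h1)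
    let s : (U → ℂ) →ₗ[ℂ] ℂ := Fintype.linearCombination ℂ fun _ => (1 : ℂ)
    have h3 : LinearMap.ker s ≠ ⊤ := by
      obtain ⟨v, hv⟩ := Quotient.exists_rep c
      intro h
      have : Pi.single (⟨v, hv⟩ : U) (1 : ℂ) ∈ LinearMap.ker s := h ▸ Submodule.mem_top
      rw [LinearMap.mem_ker, Fintype.linearCombination_apply_single] at this
      simp at this
    have h4 := Submodule.finrank_lt h3
    have h5 : Submodule.span ℂ (Set.range fun e : F => restrictTo c (G.gainRow (fun _ => 1) e)) ≤
        LinearMap.ker s := by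
      rw [Submodule.span_le]
      rintro _ ⟨⟨e, he⟩, rfl⟩
      have hh : G.component (G.head e) = c := by rw [← component_tail_eq_head]; exact he
      have h6 : restrictTo c (G.gainRow (fun _ => 1) e) =
          (Pi.single (⟨G.tail e, he⟩ : U) 1 - Pi.single (⟨G.head e, hh⟩ : U) 1 : U → ℂ) := by
        ext ⟨v, hv⟩
        simp [restrictTo, gainRow, LinearMap.funLeft_apply, Pi.single_apply]
      change s (restrictTo c (G.gainRow (fun _ => 1) e)) = 0
      rw [h6, map_sub, Fintype.linearCombination_apply_single,
        Fintype.linearCombination_apply_single, sub_self]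
    have h7 := Submodule.finrank_mono h5
    have h8 : Fintype.card F < Fintype.card U := by
      rw [← Module.finrank_fintype_fun_eq_card ℂ (η := U)]
      exact (h2.symm.le.trans h7).trans_lt h4
    exact absurd hge (not_le.2 h8)
  have key : ∀ C₁ C₂, G.IsCycleIn c C₁ → G.IsCycleIn c C₂ → C₁ ⊆ C₂ := by
    intro C₁ C₂ h₁ h₂ e he
    -- Take `e` in the first cycle only and `f` in the second. Both can be deleted without shrinking
    -- the span of the incidence rows, and the remaining rows with one unit vector span everything
    -- on the component. So |U| ≤ |F| - 2 + 1, against |F| ≤ |U|.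
    by_contra heC
    obtain ⟨f, hf⟩ := h₂.nonempty
    have hef : e ≠ f := fun h => heC (h ▸ hf)
    let A : Set E := F \ {e, f}
    have hfA : G.incRow f ∈ Submodule.span ℂ (G.incRow '' A) := by
      refine Submodule.span_mono (Set.image_mono ?_) (h₂.incRow_mem_span hf)
      rintro x ⟨hx, hxf⟩
      refine ⟨hFc h₂ hx, ?_⟩
      rintro (rfl | rfl)
      · exact heC hx
      · exact hxf rfl
    have heA : G.incRow e ∈ Submodule.span ℂ (G.incRow '' A) := by
      have : Submodule.span ℂ (G.incRow '' (C₁ \ {e})) ≤ Submodule.span ℂ (G.incRow '' A) := by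
        rw [Submodule.span_le]
        rintro _ ⟨x, ⟨hx, hxe⟩, rfl⟩
        by_cases hxf : x = f
        · exact hxf ▸ hfA
        · exact Submodule.subset_span ⟨x, ⟨hFc h₁ hx, by rintro (h | h) <;> contradiction⟩, rfl⟩
      exact this (h₁.incRow_mem_span he)
    have hFA : Submodule.span ℂ (G.incRow '' F) ≤ Submodule.span ℂ (G.incRow '' A) := by
      rw [Submodule.span_le]
      rintro _ ⟨x, hx, rfl⟩
      by_cases hxe : x = e
      · exact hxe ▸ heA
      by_cases hxf : x = f
      · exact hxf ▸ hfA
      exact Submodule.subset_span ⟨x, ⟨hx, by rintro (h | h) <;> contradiction⟩, rfl⟩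
    obtain ⟨b, hb⟩ := Quotient.exists_rep c
    have hb : G.component b = c := hb
    let T : Set (V → ℂ) := insert (Pi.single b 1) (G.incRow '' A)
    have hT : ⊤ ≤ Submodule.span ℂ (restrictTo c '' T) := by
      rw [← Pi.basisFun ℂ U |>.span_eq, Submodule.span_le]
      rintro _ ⟨⟨v, hv⟩, rfl⟩
      obtain ⟨p, hp⟩ := component_eq_iff.1 (hv.trans hb.symm)
      have h1 := hFA (single_sub_single_mem_span hp (A := F) fun d hd =>
        (hp.component_tail d hd).trans hv)
      have h2 : (Pi.single v 1 : V → ℂ) ∈ Submodule.span ℂ T := by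
        have h3 := Submodule.add_mem _ (Submodule.span_mono (Set.subset_insert _ _) h1)
          (Submodule.subset_span (Set.mem_insert (Pi.single b (1 : ℂ)) (G.incRow '' A)))
        rwa [sub_add_cancel] at h3
      have h4 := Submodule.mem_map_of_mem (f := restrictTo c) h2
      rw [Submodule.map_span] at h4
      have h5 : Pi.basisFun ℂ U ⟨v, hv⟩ = restrictTo c (Pi.single v 1) := by
        ext ⟨w, hw⟩
        simp only [restrictTo, Pi.basisFun_apply, LinearMap.funLeft_apply, Pi.single_apply]
        exact if_congr Subtype.mk_eq_mk rfl rfl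
      rw [h5]
      exact h4
    have hTf : T.Finite := (Set.toFinite _).insert _
    have := (hTf.image (restrictTo c)).fintype
    have h5 := finrank_span_le_card (R := ℂ) (restrictTo c '' T)
    rw [top_le_iff.1 hT, finrank_top, Module.finrank_fintype_fun_eq_card,
      ← Set.ncard_eq_toFinset_card'] at h5
    have h6 : (restrictTo c '' T).ncard ≤ T.ncard := Set.ncard_image_le hTf
    have h7 : T.ncard ≤ (G.incRow '' A).ncard + 1 := Set.ncard_insert_le _ _
    have h8 : (G.incRow '' A).ncard ≤ A.ncard := Set.ncard_image_le
    have h9 : A.ncard + 2 = F.ncard := by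
      rw [← Set.ncard_pair hef]
      refine Set.ncard_sdiff_add_ncard_of_subset ?_
      rintro x (rfl | rfl)
      · exact hFc h₁ he
      · exact hFc h₂ hf
    have h10 : F.ncard = Fintype.card F := by
      rw [← Nat.card_coe_set_eq, Nat.card_eq_fintype_card]
    have h11 : F.ncard ≤ Fintype.card U := h10.trans_le hle
    have h12 := h11.trans h5
    omega
  exact ⟨C, hC, fun D hD => (key D C hD hC).antisymm (key C D hC hD)⟩

end Rows

end ColoredGraph


theorem mem_translations {k : ℕ} {γ : CrystGroup k} : γ ∈ translations k ↔ γ.right = 1 := by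
  rw [translations, SemidirectProduct.range_inl_eq_ker_rightHom, MonoidHom.mem_ker]
  rfl

/-! ### Affine actions of `Γ_k` on `ℂ` -/

/-- An equivariant map from `ℤ²` to a complex vector space on which `ℤ/k` acts by scalars. -/
structure AffineModel (k : ℕ) where
  /-- The dimension of the vector space. -/
  d : ℕ
  /-- The equivariant map. -/
  φ : (Fin 2 → ℤ) →+ (Fin d → ℂ)
  /-- The scalars by which `ℤ/k` acts. -/
  χ : Multiplicative (ZMod k) →* Circle
  χ_injective : Function.Injective χ
  φ_mulVec : ∀ r t, φ ((rotMatHom k r).mulVec t) = (χ r : ℂ) • φ t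
  span_φ : Submodule.span ℂ (Set.range φ) = ⊤

namespace AffineModel

variable {k : ℕ} (A : AffineModel k)

/-- The image in the model of the translational part of an element of `Γ_k`. -/
def transl (γ : CrystGroup k) : Fin A.d → ℂ := A.φ γ.left.toAdd

theorem transl_mul (γ γ' : CrystGroup k) :
    A.transl (γ * γ') = A.transl γ + (A.χ γ.right : ℂ) • A.transl γ' := by
  have h := A.φ_mulVec γ.right γ'.left.toAdd
  rw [transl, transl, transl, ← h]
  exact map_add A.φ _ _

theorem transl_one : A.transl 1 = 0 := map_zero A.φ

/-- The subspace spanned by the translational parts of the elements of a subgroup. -/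
def translSpan (H : Subgroup (CrystGroup k)) : Submodule ℂ (Fin A.d → ℂ) :=
  Submodule.span ℂ (A.transl '' H)

/-- The affine action of `Γ_k` on `ℂ` that belongs to a linear functional on the model. -/
def act (L : Module.Dual ℂ (Fin A.d → ℂ)) (γ : CrystGroup k) (z : ℂ) : ℂ :=
  A.χ γ.right * z + L (A.transl γ)

variable {A} {L : Module.Dual ℂ (Fin A.d → ℂ)}

theorem act_mul (γ γ' : CrystGroup k) (z : ℂ) :
    A.act L (γ * γ') z = A.act L γ (A.act L γ' z) := by
  simp only [act, transl_mul, map_add, map_smul, SemidirectProduct.mul_right, map_mul,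
    Circle.coe_mul, smul_eq_mul]
  ring

theorem act_one (z : ℂ) : A.act L 1 z = z := by
  simp [act, transl_one]

theorem act_inv_act (γ : CrystGroup k) (z : ℂ) : A.act L γ⁻¹ (A.act L γ z) = z := by
  rw [← act_mul, inv_mul_cancel, act_one]

theorem act_act_inv (γ : CrystGroup k) (z : ℂ) : A.act L γ (A.act L γ⁻¹ z) = z := by
  rw [← act_mul, mul_inv_cancel, act_one]

theorem act_of_right_eq_one {γ : CrystGroup k} (h : γ.right = 1) (z : ℂ) :
    A.act L γ z = z + L (A.transl γ) := by
  simp [act, h]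

theorem χ_ne_one {γ : CrystGroup k} (h : γ ∉ translations k) : (A.χ γ.right : ℂ) ≠ 1 := by
  rw [mem_translations] at h
  rw [Ne, Circle.coe_eq_one, ← map_one A.χ]
  exact fun h' => h (A.χ_injective h')

variable (A L) in
/-- The kernel of the affine action. -/
def actKer : Subgroup (CrystGroup k) where
  carrier := {γ | ∀ z, A.act L γ z = z}
  one_mem' := act_one
  mul_mem' h h' z := by rw [act_mul, h', h]
  inv_mem' {γ} h z := by
    have := act_inv_act (L := L) γ z
    rwa [h z] at this

theorem mem_actKer_iff {γ : CrystGroup k} (h : γ ∈ translations k) :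
    γ ∈ A.actKer L ↔ L (A.transl γ) = 0 := by
  rw [mem_translations] at h
  constructor
  · intro h'
    have := h' 0
    rwa [act_of_right_eq_one h, zero_add] at this
  · intro h' z
    rw [act_of_right_eq_one h, h', add_zero]

theorem map_transl_eq_zero_of_mem_actKer {γ : CrystGroup k} (h : γ ∈ A.actKer L) :
    L (A.transl γ) = 0 := by
  have := h 0
  rwa [act, mul_zero, zero_add] at this

/-- A subgroup whose translations act trivially has a fixed point. -/
theorem exists_fixed {H : Subgroup (CrystGroup k)} (hH : transSubgroup H ≤ A.actKer L) :
    ∃ z, ∀ γ ∈ H, A.act L γ z = z := by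
  by_cases h : HasRotation H
  · obtain ⟨γ, hγ, hγt⟩ := h
    have h1 : (1 : ℂ) - A.χ γ.right ≠ 0 := sub_ne_zero.2 (χ_ne_one hγt).symm
    have huniq : ∀ w, A.act L γ w = w → w = L (A.transl γ) / (1 - A.χ γ.right) := by
      intro w hw
      rw [eq_div_iff h1]
      rw [act] at hw
      linear_combination -hw
    have hz : A.act L γ (L (A.transl γ) / (1 - A.χ γ.right)) =
        L (A.transl γ) / (1 - A.χ γ.right) := by
      rw [act]
      field_simp
      ring
    refine ⟨_, fun δ hδ => huniq _ ?_⟩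
    -- As ℤ/k is abelian, this commutator is a translation and acts trivially. So `δ` commutes with
    -- `γ` in the action and maps the unique fixed point of `γ` to a fixed point of `γ`.
    have hcomm : γ * δ * γ⁻¹ * δ⁻¹ ∈ transSubgroup H := by
      refine ⟨H.mul_mem (H.mul_mem (H.mul_mem hγ hδ) (H.inv_mem hγ)) (H.inv_mem hδ), ?_⟩
      refine mem_translations.2 ?_
      simp
    have h2 := hH hcomm (A.act L (δ * γ) (L (A.transl γ) / (1 - A.χ γ.right)))
    rw [← act_mul, show γ * δ * γ⁻¹ * δ⁻¹ * (δ * γ) = γ * δ by group, act_mul, act_mul, hz] at h2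
    exact h2
  · have h' : ∀ γ ∈ H, γ ∈ translations k := by
      simpa [HasRotation] using h
    exact ⟨0, fun γ hγ => hH ⟨hγ, h' γ hγ⟩ 0⟩

/-! ### The rank formula -/

section Rank

open ColoredGraph

variable {V E : Type*} {G : ColoredGraph k V E}

theorem transGroup_le_iff {B : G.BaseVertices} {K : Subgroup (CrystGroup k)} :
    transGroup B ≤ K ↔ ∀ c, transSubgroup (G.rhoImage (B.vertex c)) ≤ K := iSup_le_iff

theorem transGroup_le_translations (B : G.BaseVertices) : transGroup B ≤ translations k :=
  transGroup_le_iff.2 fun _ => inf_le_right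

theorem transGroup_le_actKer_iff {B : G.BaseVertices} :
    transGroup B ≤ A.actKer L ↔ L ∈ (A.translSpan (transGroup B)).dualAnnihilator := by
  rw [Submodule.mem_dualAnnihilator]
  constructor
  · intro h w hw
    have : A.translSpan (transGroup B) ≤ LinearMap.ker L := by
      rw [translSpan, Submodule.span_le]
      rintro _ ⟨γ, hγ, rfl⟩
      exact map_transl_eq_zero_of_mem_actKer (h hγ)
    exact this hw
  · intro h γ hγ
    rw [mem_actKer_iff (transGroup_le_translations B hγ)]
    exact h _ (Submodule.subset_span ⟨γ, hγ, rfl⟩)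

variable [DecidableEq V]

variable (A) in
/-- The row of an edge: the linear condition `x_i = γ · x_j` on the positions `x` of the vertices
and the affine action of `Γ_k` on `ℂ`. -/
def row (G : ColoredGraph k V E) (e : E) : (V → ℂ) × (Fin A.d → ℂ) :=
  (G.gainRow (fun e => (A.χ (G.color e).right : ℂ)) e, -A.transl (G.color e))

/-- The position of a vertex. -/
def pos (l : Module.Dual ℂ ((V → ℂ) × (Fin A.d → ℂ))) (v : V) : ℂ := l (Pi.single v 1, 0)

/-- The functional on the model that determines the action. -/
def lattice (l : Module.Dual ℂ ((V → ℂ) × (Fin A.d → ℂ))) : Module.Dual ℂ (Fin A.d → ℂ) :=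
  l ∘ₗ LinearMap.inr ℂ _ _

theorem apply_row (l : Module.Dual ℂ ((V → ℂ) × (Fin A.d → ℂ))) (e : E) :
    l (A.row G e) = pos l (G.tail e) - A.act (lattice l) (G.color e) (pos l (G.head e)) := by
  have : A.row G e = (Pi.single (G.tail e) 1, 0) -
      (A.χ (G.color e).right : ℂ) • (Pi.single (G.head e) 1, 0) -
      LinearMap.inr ℂ _ _ (A.transl (G.color e)) := by
    ext <;> simp [row, gainRow]
  rw [this, map_sub, map_sub, map_smul, act, sub_sub]
  rfl

variable (A) in
/-- The space of all positions and actions that satisfy the conditions of all edges. -/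
def solutions (G : ColoredGraph k V E) : Submodule ℂ (Module.Dual ℂ ((V → ℂ) × (Fin A.d → ℂ))) where
  carrier := {l | ∀ e, l (A.row G e) = 0}
  add_mem' h h' e := by simp [h e, h' e]
  zero_mem' e := rfl
  smul_mem' t l h e := by simp [h e]

theorem pos_of_isWalk {l : Module.Dual ℂ ((V → ℂ) × (Fin A.d → ℂ))} (hl : l ∈ A.solutions G)
    {u v : V} {p : List (E × Bool)} (hp : G.IsWalk u v p) :
    pos l u = A.act (lattice l) (G.rho p) (pos l v) := by
  induction p generalizing u with
  | nil =>
    cases hp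
    simp [rho, act_one]
  | cons d p ih =>
    have h1 : G.rho (d :: p) = G.rho [d] * G.rho p := rho_append [d] p
    rw [h1, act_mul, ← ih hp.2, ← hp.1]
    have h2 := hl d.1
    rw [apply_row, sub_eq_zero] at h2
    obtain ⟨e, _ | _⟩ := d
    · simp only [start, finish, rho, List.map_cons, List.map_nil, List.prod_singleton]
      simp only [Bool.false_eq_true, if_false]
      rw [h2, act_inv_act]
    · simpa [start, finish, rho] using h2

/-- A closed walk with a translation as its ρ-image forces x = x + L(translation) for the position x
of the base vertex. -/
theorem lattice_mem {l : Module.Dual ℂ ((V → ℂ) × (Fin A.d → ℂ))} (hl : l ∈ A.solutions G)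
    (B : G.BaseVertices) : lattice l ∈ (A.translSpan (transGroup B)).dualAnnihilator := by
  rw [← transGroup_le_actKer_iff, transGroup_le_iff]
  rintro c γ ⟨⟨p, hp, rfl⟩, hγ⟩
  rw [mem_actKer_iff hγ]
  have := pos_of_isWalk hl hp
  rw [act_of_right_eq_one (mem_translations.1 hγ)] at this
  linear_combination -this

variable [Fintype V]

/-- Positions are carried from the base vertices along walks. Two walks to the same base vertex
differ by a closed walk there, which fixes the base position, so the choice of walk is immaterial.
-/
theorem exists_solution (B : G.BaseVertices) (L : Module.Dual ℂ (Fin A.d → ℂ))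
    (z : G.Component → ℂ) (hz : ∀ c, ∀ γ ∈ G.rhoImage (B.vertex c), A.act L γ (z c) = z c) :
    ∃ l ∈ A.solutions G, lattice l = L ∧ ∀ c, pos l (B.vertex c) = z c := by
  have hwalk : ∀ v, ∃ p, G.IsWalk v (B.vertex (G.component v)) p := fun v =>
    component_eq_iff.1 (B.component_vertex _).symm
  choose p hp using hwalk
  let x : V → ℂ := fun v => A.act L (G.rho (p v)) (z (G.component v))
  let l : Module.Dual ℂ ((V → ℂ) × (Fin A.d → ℂ)) :=
    (Fintype.linearCombination ℂ x).coprod L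
  have hx : ∀ v, pos l v = x v := fun v => by
    simp [l, pos, Fintype.linearCombination_apply_single]
  have hL : lattice l = L := by
    simp [l, lattice]
  have key : ∀ u v q, G.IsWalk u v q → x u = A.act L (G.rho q) (x v) := by
    intro u v q hq
    have huv : G.component u = G.component v := component_eq_iff.2 ⟨q, hq⟩
    have h1 := hp v
    rw [← huv] at h1
    have h2 := hz (G.component u) _ ⟨_, (hp u).reverse.append (hq.append h1), rfl⟩
    rw [rho_append, rho_append, rho_reverse, act_mul, act_mul] at h2
    have h3 := congrArg (A.act L (G.rho (p u))) h2
    rw [act_act_inv] at h3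
    simp only [x]
    rw [← h3, huv]
  refine ⟨l, fun e => ?_, hL, fun c => ?_⟩
  · rw [apply_row, hx, hx, hL, sub_eq_zero]
    have := key _ _ [(e, true)] (isWalk_step (G := G) (e, true))
    simpa [start, finish, rho] using this
  · rw [hx]
    have hc := B.component_vertex c
    have h1 := hp (B.vertex c)
    rw [hc] at h1
    have := hz c _ ⟨_, h1, rfl⟩
    simp only [x]
    rw [hc, this]

/-- The solution space is fibered over its action parameters: the image of `π` is the annihilator of
the span of Λ(G, B), and its kernel has one free complex number per component without rotation. -/
theorem finrank_span_row (B : G.BaseVertices) :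
    Module.finrank ℂ (Submodule.span ℂ (Set.range (A.row G))) +
        Nat.card {c // ¬ HasRotation (G.rhoImage (B.vertex c))} =
      Fintype.card V + Module.finrank ℂ (A.translSpan (transGroup B)) := by
  classical
  have : Fintype {c // ¬ HasRotation (G.rhoImage (B.vertex c))} := Fintype.ofFinite _
  have h1 := finrank_span_range_add (A.row G) (A.solutions G) fun l => Iff.rfl
  let π : A.solutions G →ₗ[ℂ] Module.Dual ℂ (Fin A.d → ℂ) :=
    { toFun := fun l => lattice l.1
      map_add' := fun l l' => LinearMap.add_comp _ _ _
      map_smul' := fun t l => LinearMap.smul_comp _ _ _ }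
  have h2 := LinearMap.finrank_range_add_finrank_ker π
  have h3 : LinearMap.range π = (A.translSpan (transGroup B)).dualAnnihilator := by
    refine le_antisymm ?_ fun L hL => ?_
    · rintro _ ⟨l, rfl⟩
      exact lattice_mem l.2 B
    · choose z hz using fun c =>
        exists_fixed (transGroup_le_iff.1 (transGroup_le_actKer_iff.2 hL) c)
      obtain ⟨l, hl, hlL, -⟩ := exists_solution B L z hz
      exact ⟨⟨l, hl⟩, hlL⟩
  let ev : LinearMap.ker π →ₗ[ℂ] ({c // ¬ HasRotation (G.rhoImage (B.vertex c))} → ℂ) :=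
    { toFun := fun l c => pos l.1.1 (B.vertex c.1)
      map_add' := fun l l' => rfl
      map_smul' := fun t l => rfl }
  have hinj : Function.Injective ev := by
    rw [injective_iff_map_eq_zero]
    rintro ⟨⟨l, hl⟩, hl0⟩ hev
    have hl0 : lattice l = 0 := hl0
    have hb : ∀ c, pos l (B.vertex c) = 0 := by
      intro c
      by_cases hc : HasRotation (G.rhoImage (B.vertex c))
      -- With L = 0 a rotation is multiplication by a scalar other than 1, so its only fixed point
      -- is 0.
      · obtain ⟨_, ⟨p, hp, rfl⟩, hr⟩ := hc
        have := pos_of_isWalk hl hp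
        rw [hl0, act, LinearMap.zero_apply, add_zero] at this
        have h4 : ((A.χ (G.rho p).right : ℂ) - 1) * pos l (B.vertex c) = 0 := by
          linear_combination -this
        exact (mul_eq_zero.1 h4).resolve_left (sub_ne_zero.2 (χ_ne_one hr))
      · exact congrFun hev ⟨c, hc⟩
    have hx : ∀ v, pos l v = 0 := by
      intro v
      obtain ⟨p, hp⟩ := component_eq_iff.1 (B.component_vertex (G.component v)).symm
      rw [pos_of_isWalk hl hp, hb, hl0]
      simp [act]
    have : l = 0 := by
      refine LinearMap.prod_ext (LinearMap.pi_ext' fun v => LinearMap.ext_ring ?_) hl0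
      exact hx v
    ext1
    ext1
    exact this
  have hsurj : Function.Surjective ev := by
    intro z
    obtain ⟨l, hl, hl0, hlz⟩ := exists_solution B (0 : Module.Dual ℂ (Fin A.d → ℂ))
      (fun c => if h : HasRotation (G.rhoImage (B.vertex c)) then 0 else z ⟨c, h⟩) (by
        intro c γ hγ
        split_ifs with h
        · simp [act]
        · have : γ ∈ translations k := by
            by_contra h'
            exact h ⟨γ, hγ, h'⟩
          rw [act_of_right_eq_one (mem_translations.1 this)]
          simp)
    refine ⟨⟨⟨l, hl⟩, hl0⟩, ?_⟩
    ext ⟨c, hc⟩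
    change pos l (B.vertex c) = z ⟨c, hc⟩
    rw [hlz, dif_neg hc]
  have h4 := (LinearEquiv.ofBijective ev ⟨hinj, hsurj⟩).finrank_eq
  have h5 := Subspace.finrank_add_finrank_dualAnnihilator_eq (A.translSpan (transGroup B))
  rw [Module.finrank_fintype_fun_eq_card] at h4
  rw [Module.finrank_prod, Module.finrank_fintype_fun_eq_card,
    Module.finrank_fintype_fun_eq_card] at h1
  rw [Module.finrank_fintype_fun_eq_card] at h5
  rw [h3, h4] at h2
  rw [Nat.card_eq_fintype_card]
  omega

end Rank

end AffineModel


/-! ### Euclidean motions -/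

namespace Euc2

/-- The translation vector of a Euclidean motion. -/
def vec (g : Euc2) : Fin 2 → ℝ := g.left.toAdd

/-- The orthogonal matrix of a Euclidean motion. -/
def mat (g : Euc2) : Matrix (Fin 2) (Fin 2) ℝ := g.right

theorem vec_mul (g h : Euc2) : vec (g * h) = vec g + (mat g).mulVec (vec h) := by
  rfl

theorem mat_mul (g h : Euc2) : mat (g * h) = mat g * mat h := by
  rfl

theorem vec_one : vec 1 = 0 := by
  rfl

theorem mat_one : mat 1 = 1 := by
  rfl

theorem ext_iff {g h : Euc2} : g = h ↔ vec g = vec h ∧ mat g = mat h := by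
  constructor
  · rintro rfl
    exact ⟨rfl, rfl⟩
  · rintro ⟨h1, h2⟩
    exact SemidirectProduct.ext h1 (Subtype.ext h2)

theorem coord_injective : Function.Injective coord := fun _ _ hgh =>
  ext_iff.2 ⟨congrArg Prod.fst hgh, congrArg Prod.snd hgh⟩

theorem transpose_mul_mat (g : Euc2) : (mat g).transpose * mat g = 1 :=
  (Matrix.mem_orthogonalGroup_iff' _ _).1 g.right.2

theorem mat_mulVec_inv_mul (g h : Euc2) :
    (mat g).mulVec (vec (g⁻¹ * h)) = vec h - vec g := by
  have := vec_mul g (g⁻¹ * h)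
  rw [mul_inv_cancel_left] at this
  rw [this]
  simp

theorem vec_inv_mul (g h : Euc2) :
    vec (g⁻¹ * h) = (mat g).transpose.mulVec (vec h - vec g) := by
  rw [← mat_mulVec_inv_mul, Matrix.mulVec_mulVec, transpose_mul_mat, Matrix.one_mulVec]

theorem mat_inv_mul_sub_one (g h : Euc2) :
    mat (g⁻¹ * h) - 1 = (mat g).transpose * (mat h - mat g) := by
  have h1 : mat h = mat g * mat (g⁻¹ * h) := by rw [← mat_mul, mul_inv_cancel_left]
  rw [Matrix.mul_sub, transpose_mul_mat, h1, ← Matrix.mul_assoc, transpose_mul_mat, Matrix.one_mul]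

theorem abs_mat_le_one (g : Euc2) (i j : Fin 2) : |mat g i j| ≤ 1 :=
  entry_norm_bound_of_unitary g.right.2 i j

/-- Makes discreteness at the identity uniform over the whole image. The factor 2 counts the
summands of a 2 × 2 matrix product, each with an orthogonal-matrix entry of modulus at most 1. -/
theorem dist_coord_inv_mul_le (g h : Euc2) :
    dist (coord (g⁻¹ * h)) (coord 1) ≤ 2 * dist (coord g) (coord h) := by
  have hv : ∀ i, |vec h i - vec g i| ≤ dist (coord g) (coord h) := fun i => by
    rw [← Real.dist_eq, dist_comm]
    exact (dist_le_pi_dist (vec g) (vec h) i).trans (le_max_left _ _)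
  have hm : ∀ i j, |mat h i j - mat g i j| ≤ dist (coord g) (coord h) := fun i j => by
    rw [← Real.dist_eq, dist_comm]
    refine le_trans ?_ (le_max_right _ _)
    exact (dist_le_pi_dist (mat g i) (mat h i) j).trans
      (dist_le_pi_dist (fun i => mat g i) (fun i => mat h i) i)
  have key : ∀ a b x y : ℝ, |a| ≤ 1 → |b| ≤ 1 → |x| ≤ dist (coord g) (coord h) →
      |y| ≤ dist (coord g) (coord h) → |a * x + b * y| ≤ 2 * dist (coord g) (coord h) := by
    intro a b x y ha hb hx hy
    have h1 : |a * x| ≤ 1 * dist (coord g) (coord h) := by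
      rw [abs_mul]
      exact mul_le_mul ha hx (abs_nonneg _) zero_le_one
    have h2 : |b * y| ≤ 1 * dist (coord g) (coord h) := by
      rw [abs_mul]
      exact mul_le_mul hb hy (abs_nonneg _) zero_le_one
    linarith [abs_add_le (a * x) (b * y)]
  have h0 : 0 ≤ 2 * dist (coord g) (coord h) := by positivity
  refine max_le ((dist_pi_le_iff h0).2 fun i => ?_)
    ((dist_pi_le_iff h0).2 fun i => (dist_pi_le_iff h0).2 fun j => ?_)
  · change dist (vec (g⁻¹ * h) i) (vec 1 i) ≤ _
    rw [vec_one, Real.dist_eq, Pi.zero_apply, sub_zero, vec_inv_mul]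
    simp only [Matrix.mulVec, dotProduct, Fin.sum_univ_two, Matrix.transpose_apply, Pi.sub_apply]
    exact key _ _ _ _ (abs_mat_le_one ..) (abs_mat_le_one ..) (hv _) (hv _)
  · change dist (mat (g⁻¹ * h) i j) (mat 1 i j) ≤ _
    rw [mat_one, Real.dist_eq, ← Matrix.sub_apply, mat_inv_mul_sub_one]
    simp only [Matrix.mul_apply, Fin.sum_univ_two, Matrix.transpose_apply, Matrix.sub_apply]
    exact key _ _ _ _ (abs_mat_le_one ..) (abs_mat_le_one ..) (hm _ _) (hm _ _)

end Euc2

/-! ### Discrete faithful representations send translations to translations -/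

open Euc2

theorem exists_dist_of_mem_rep {k : ℕ} {Ψ : CrystGroup k →* Euc2} (h : Ψ ∈ Rep k) :
    ∃ δ > 0, ∀ γ, dist (coord (Ψ γ)) (coord 1) < δ → γ = 1 := by
  obtain ⟨hinj, hd⟩ := h
  obtain ⟨δ, hδ, hball⟩ := Metric.exists_ball_inter_eq_singleton_of_mem_discrete
    (isDiscrete_iff_discreteTopology.2 hd) (x := coord 1) ⟨1, by simp⟩
  refine ⟨δ, hδ, fun γ hγ => hinj (coord_injective ?_)⟩
  have : coord (Ψ γ) ∈ Metric.ball (coord 1) δ ∩ Set.range fun γ => coord (Ψ γ) := ⟨hγ, γ, rfl⟩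
  rw [hball] at this
  rw [this, map_one]

/-- A discrete faithful representation has only finitely many values of bounded translation
length. -/
theorem false_of_bounded {k : ℕ} {Ψ : CrystGroup k →* Euc2} (h : Ψ ∈ Rep k) {s : ℕ → CrystGroup k}
    (hs : Function.Injective s) {C : ℝ} (hC : ∀ n, ‖vec (Ψ (s n))‖ ≤ C) : False := by
  obtain ⟨δ, hδ, hsep⟩ := exists_dist_of_mem_rep h
  have hb : ∀ n, coord (Ψ (s n)) ∈ Metric.closedBall 0 (max C 1) := by
    intro n
    rw [mem_closedBall_zero_iff]
    refine max_le ((hC n).trans (le_max_left _ _)) (le_trans ?_ (le_max_right _ _))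
    exact (pi_norm_le_iff_of_nonneg zero_le_one).2 fun i =>
      (pi_norm_le_iff_of_nonneg zero_le_one).2 fun j => abs_mat_le_one _ i j
  -- Orthogonal matrices are bounded, so Bolzano–Weierstrass applies. Two values at distance below
  -- δ/2 have a quotient within δ of the identity, hence coincide.
  obtain ⟨a, -, φ, hφ, hlim⟩ := tendsto_subseq_of_bounded Metric.isBounded_closedBall hb
  obtain ⟨N, hN⟩ := Metric.cauchySeq_iff'.1 hlim.cauchySeq (δ / 2) (by positivity)
  have h1 := hN (N + 1) (by omega)
  have h2 := dist_coord_inv_mul_le (Ψ (s (φ (N + 1)))) (Ψ (s (φ N)))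
  rw [← map_inv, ← map_mul] at h2
  have h3 := hsep _ (h2.trans_lt (by
    have h4 : dist (coord (Ψ (s (φ (N + 1))))) (coord (Ψ (s (φ N)))) < δ / 2 := h1
    linarith))
  have h4 := hφ.injective (hs (inv_mul_eq_one.1 h3))
  omega

/-- Two independent fixed vectors would force A = 1, so the fixed space is spanned by a single
vector, possibly 0. -/
theorem exists_fixed_vector {A : Matrix (Fin 2) (Fin 2) ℝ} (hA : A ≠ 1) :
    ∃ u, A.mulVec u = u ∧ ∀ x, A.mulVec x = x → ∃ c : ℝ, x = c • u := by
  by_cases h : ∃ u, u ≠ 0 ∧ A.mulVec u = u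
  · obtain ⟨u, hu0, hu⟩ := h
    refine ⟨u, hu, fun x hx => ?_⟩
    have e1 := congrFun hu 0
    have e2 := congrFun hu 1
    have e3 := congrFun hx 0
    have e4 := congrFun hx 1
    simp only [Matrix.mulVec, dotProduct, Fin.sum_univ_two] at e1 e2 e3 e4
    have hdet : u 0 * x 1 - u 1 * x 0 = 0 := by
      by_contra hd
      refine hA ?_
      have z1 : A 0 0 - 1 = 0 := by
        refine (mul_eq_zero.1 ?_).resolve_right hd
        linear_combination x 1 * e1 - u 1 * e3
      have z2 : A 0 1 = 0 := by
        refine (mul_eq_zero.1 ?_).resolve_right hd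
        linear_combination u 0 * e3 - x 0 * e1
      have z3 : A 1 0 = 0 := by
        refine (mul_eq_zero.1 ?_).resolve_right hd
        linear_combination x 1 * e2 - u 1 * e4
      have z4 : A 1 1 - 1 = 0 := by
        refine (mul_eq_zero.1 ?_).resolve_right hd
        linear_combination u 0 * e4 - x 0 * e2
      ext i j
      fin_cases i <;> fin_cases j <;> simp [z2, z3, sub_eq_zero.1 z1, sub_eq_zero.1 z4]
    have hn : u 0 * u 0 + u 1 * u 1 ≠ 0 := by
      intro hn
      refine hu0 (dotProduct_self_eq_zero.1 ?_)
      rwa [dotProduct, Fin.sum_univ_two]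
    refine ⟨(x 0 * u 0 + x 1 * u 1) / (u 0 * u 0 + u 1 * u 1), ?_⟩
    ext i
    fin_cases i
    · simp only [Fin.zero_eta, Pi.smul_apply, smul_eq_mul]
      rw [div_mul_eq_mul_div, eq_div_iff hn]
      linear_combination -u 1 * hdet
    · simp only [Fin.mk_one, Pi.smul_apply, smul_eq_mul]
      rw [div_mul_eq_mul_div, eq_div_iff hn]
      linear_combination u 0 * hdet
  · push Not at h
    refine ⟨0, Matrix.mulVec_zero _, fun x hx => ⟨0, ?_⟩⟩
    by_contra hx0
    exact h x (by simpa using hx0) hx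

theorem map_lattice_eq {M : Type*} [AddCommGroup M] (f : (Fin 2 → ℤ) →+ M) (t : Fin 2 → ℤ) :
    f t = t 0 • f (Pi.single 0 1) + t 1 • f (Pi.single 1 1) := by
  rw [← map_zsmul, ← map_zsmul, ← map_add]
  congr 1
  ext i
  fin_cases i <;> simp

/-- A homomorphism `ℤ² → ℝ` is bounded on an infinite set. -/
theorem exists_injective_bounded (f : (Fin 2 → ℤ) →+ ℝ) :
    ∃ (w : ℕ → Fin 2 → ℤ) (C : ℝ), Function.Injective w ∧ ∀ n, |f (w n)| ≤ C := by
  set α := f (Pi.single 0 1) with hα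
  set β := f (Pi.single 1 1) with hβ
  by_cases h : β = 0
  · refine ⟨fun n => Pi.single 1 (n : ℤ), 0, fun m n hmn => ?_, fun n => ?_⟩
    · simpa using congrFun hmn 1
    · rw [map_lattice_eq]
      simp [← hβ, h]
  -- Subtracting the integer part of nα/β times β from nα leaves the fractional part times β.
  · refine ⟨fun n => ![n, -⌊n * α / β⌋], |β|, fun m n hmn => ?_, fun n => ?_⟩
    · simpa using congrFun hmn 0
    · rw [map_lattice_eq, ← hα, ← hβ]
      have h1 : ((![(n : ℤ), -⌊n * α / β⌋] : Fin 2 → ℤ) 0) • α +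
          ((![(n : ℤ), -⌊n * α / β⌋] : Fin 2 → ℤ) 1) • β = Int.fract (n * α / β) * β := by
        simp only [Matrix.cons_val_zero, Matrix.cons_val_one, zsmul_eq_mul,
          Int.fract, Int.cast_natCast, Int.cast_neg]
        field_simp
        ring
      rw [h1, abs_mul, abs_of_nonneg (Int.fract_nonneg _)]
      exact mul_le_of_le_one_left (abs_nonneg _) (Int.fract_lt_one _).le

theorem commute_of_mem_translations {k : ℕ} {γ δ : CrystGroup k} (hγ : γ ∈ translations k)
    (hδ : δ ∈ translations k) : γ * δ = δ * γ := by
  obtain ⟨t, rfl⟩ := hγ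
  obtain ⟨s, rfl⟩ := hδ
  rw [← map_mul, ← map_mul, mul_comm]

/-- The translation with a given integer vector. -/
def translation (k : ℕ) (t : Fin 2 → ℤ) : CrystGroup k :=
  SemidirectProduct.inl (Multiplicative.ofAdd t)

theorem translation_mem (k : ℕ) (t : Fin 2 → ℤ) : translation k t ∈ translations k := ⟨_, rfl⟩

theorem translation_add (k : ℕ) (s t : Fin 2 → ℤ) :
    translation k (s + t) = translation k s * translation k t := by
  rw [translation, ofAdd_add, map_mul]
  rfl

theorem translation_injective (k : ℕ) : Function.Injective (translation k) :=
  SemidirectProduct.inl_injective.comp Multiplicative.ofAdd.injective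

/-- A discrete faithful representation maps translations to translations. -/
theorem mat_eq_one_of_mem_translations {k : ℕ} {Ψ : CrystGroup k →* Euc2} (h : Ψ ∈ Rep k)
    {τ : CrystGroup k} (hτ : τ ∈ translations k) : mat (Ψ τ) = 1 := by
  -- If A ≠ 1, infinitely many translations get bounded translation vectors, against discreteness.
  -- Commutation with `Ψ τ` bounds (A - 1)v for the vector v of any translation; the component of v
  -- along the fixed direction `u` of A is controlled by an additive function on ℤ².
  by_contra hA
  obtain ⟨u, hu, hpar⟩ := exists_fixed_vector hA
  set A := mat (Ψ τ) with hAdef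
  have hcomm : ∀ t, Ψ τ * Ψ (translation k t) = Ψ (translation k t) * Ψ τ := fun t => by
    rw [← map_mul, ← map_mul, commute_of_mem_translations hτ (translation_mem k t)]
  -- Commuting with A, the matrix Q preserves the line of `u`, and Q is an isometry, so Qu = ±u.
  -- Doubling `t` replaces Q by Q² and removes the sign.
  have hsq : ∀ t, (mat (Ψ (translation k (t + t)))).mulVec u = u := by
    intro t
    have h1 : A * mat (Ψ (translation k t)) = mat (Ψ (translation k t)) * A :=
      congrArg mat (hcomm t)
    set Q := mat (Ψ (translation k t)) with hQ
    obtain ⟨c, hc⟩ := hpar (Q.mulVec u) (by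
      rw [Matrix.mulVec_mulVec, h1, ← Matrix.mulVec_mulVec, hu])
    have h2 : c * c * (u ⬝ᵥ u) = u ⬝ᵥ u := by
      have : Q.mulVec u ⬝ᵥ Q.mulVec u = u ⬝ᵥ u := by
        rw [Matrix.dotProduct_mulVec, ← Matrix.mulVec_transpose, Matrix.mulVec_mulVec,
          transpose_mul_mat, Matrix.one_mulVec]
      rwa [hc, smul_dotProduct, dotProduct_smul, smul_smul, smul_eq_mul] at this
    rw [translation_add, map_mul, mat_mul, ← hQ, ← Matrix.mulVec_mulVec, hc, Matrix.mulVec_smul,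
      hc, smul_smul]
    by_cases hu0 : u ⬝ᵥ u = 0
    · rw [dotProduct_self_eq_zero.1 hu0, smul_zero]
    · rw [(mul_eq_right₀ hu0).1 h2, one_smul]
  have hdot : ∀ t x, u ⬝ᵥ (mat (Ψ (translation k (t + t)))).mulVec x = u ⬝ᵥ x := by
    intro t x
    rw [Matrix.dotProduct_mulVec, ← Matrix.mulVec_transpose]
    conv_lhs => rw [← hsq t]
    rw [Matrix.mulVec_mulVec, transpose_mul_mat, Matrix.one_mulVec]
  let f : (Fin 2 → ℤ) →+ ℝ := AddMonoidHom.mk' (fun t => u ⬝ᵥ vec (Ψ (translation k (t + t))))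
    fun s t => by
      rw [add_add_add_comm, translation_add, map_mul, vec_mul, dotProduct_add, hdot]
  obtain ⟨w, C, hw, hC⟩ := exists_injective_bounded f
  -- The kernel of A - 1 is the line of `u`, on which the product with `u` is injective. So `N` is
  -- injective, and bounds on its two parts bound the vector.
  let N : (Fin 2 → ℝ) →ₗ[ℝ] (Fin 2 → ℝ) × ℝ :=
    (A - 1).mulVecLin.prod (Fintype.linearCombination ℝ u)
  have hNu : ∀ x, Fintype.linearCombination ℝ u x = u ⬝ᵥ x := fun x => by
    simp [Fintype.linearCombination_apply, dotProduct, mul_comm]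
  have hN : LinearMap.ker N = ⊥ := by
    rw [LinearMap.ker_eq_bot']
    intro x hx
    have h1 : (A - 1).mulVec x = 0 := congrArg Prod.fst hx
    have h2 : u ⬝ᵥ x = 0 := by rw [← hNu]; exact congrArg Prod.snd hx
    rw [Matrix.sub_mulVec, Matrix.one_mulVec, sub_eq_zero] at h1
    obtain ⟨c, rfl⟩ := hpar x h1
    rw [dotProduct_smul, smul_eq_mul, mul_eq_zero] at h2
    rcases h2 with rfl | h2
    · exact zero_smul _ _
    · rw [dotProduct_self_eq_zero.1 h2, smul_zero]
  obtain ⟨K, -, hK⟩ := N.exists_antilipschitzWith hN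
  -- Commutation turns the left side into (Q - 1) applied to the vector of `Ψ τ`: two summands from
  -- Q and one from the identity give the 3.
  have hbound : ∀ t, ‖(A - 1).mulVec (vec (Ψ (translation k t)))‖ ≤ 3 * ‖vec (Ψ τ)‖ := by
    intro t
    have h1 := congrArg vec (hcomm t)
    rw [vec_mul, vec_mul, ← hAdef] at h1
    have h2 : (A - 1).mulVec (vec (Ψ (translation k t))) =
        (mat (Ψ (translation k t))).mulVec (vec (Ψ τ)) - vec (Ψ τ) := by
      rw [Matrix.sub_mulVec, Matrix.one_mulVec, sub_eq_sub_iff_add_eq_add, add_comm, h1, add_comm]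
    rw [h2]
    refine (pi_norm_le_iff_of_nonneg (by positivity)).2 fun i => ?_
    have h3 : ∀ j, |mat (Ψ (translation k t)) i j * vec (Ψ τ) j| ≤ 1 * ‖vec (Ψ τ)‖ := fun j => by
      rw [abs_mul]
      exact mul_le_mul (abs_mat_le_one ..) (norm_le_pi_norm (vec (Ψ τ)) j) (abs_nonneg _)
        zero_le_one
    have h4 : |vec (Ψ τ) i| ≤ ‖vec (Ψ τ)‖ := norm_le_pi_norm (vec (Ψ τ)) i
    simp only [Pi.sub_apply, Matrix.mulVec, dotProduct, Fin.sum_univ_two, Real.norm_eq_abs]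
    have h50 := abs_le.1 (h3 0)
    have h51 := abs_le.1 (h3 1)
    have h52 := abs_le.1 h4
    rw [abs_le]
    constructor <;> linarith
  refine false_of_bounded h (s := fun n => translation k (w n + w n)) ?_
    (C := K * max (3 * ‖vec (Ψ τ)‖) C) fun n => ?_
  · intro m n hmn
    refine hw (funext fun i => ?_)
    have := congrFun (translation_injective k hmn) i
    simp only [Pi.add_apply] at this
    omega
  · have h1 := hK.le_mul_dist (vec (Ψ (translation k (w n + w n)))) 0
    rw [map_zero, dist_zero_right, dist_zero_right] at h1
    refine h1.trans (mul_le_mul_of_nonneg_left ?_ K.2)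
    refine max_le_max (hbound _) ?_
    rw [LinearMap.prod_apply]
    simp only [Function.prod_apply, hNu]
    exact hC n


/-! ### The dimension of the representation spaces -/

/-- The identification of `ℂ` with `ℝ²`. -/
def ofComplex : ℂ ≃L[ℝ] (Fin 2 → ℝ) := Complex.basisOneI.equivFunL

theorem ofComplex_apply (z : ℂ) : ofComplex z = ![z.re, z.im] := Complex.coe_basisOneI_repr z

/-- The rotation matrix of a complex number of modulus `1`. -/
def circleMatrix (z : Circle) : Matrix.orthogonalGroup (Fin 2) ℝ :=
  ⟨!![(z : ℂ).re, -(z : ℂ).im; (z : ℂ).im, (z : ℂ).re], by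
    have h : (z : ℂ).re * (z : ℂ).re + (z : ℂ).im * (z : ℂ).im = 1 := by
      rw [← Complex.normSq_apply, Circle.normSq_coe]
    rw [Matrix.mem_orthogonalGroup_iff]
    ext i j
    fin_cases i <;> fin_cases j <;>
      simp [Matrix.mul_apply, Fin.sum_univ_two, h, mul_comm]
    linarith⟩

theorem circleMatrix_one : circleMatrix 1 = 1 := by
  ext i j
  fin_cases i <;> fin_cases j <;> simp [circleMatrix]

theorem circleMatrix_mul (z w : Circle) : circleMatrix (z * w) = circleMatrix z * circleMatrix w := by
  ext i j
  fin_cases i <;> fin_cases j <;>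
    simp [circleMatrix] <;> ring

theorem circleMatrix_mulVec (z : Circle) (w : ℂ) :
    (circleMatrix z : Matrix (Fin 2) (Fin 2) ℝ).mulVec (ofComplex w) = ofComplex (z * w) := by
  rw [ofComplex_apply, ofComplex_apply]
  ext i
  fin_cases i <;> simp [circleMatrix, Matrix.mulVec, dotProduct, Fin.sum_univ_two] <;> ring

theorem circleMatrix_injective : Function.Injective circleMatrix := by
  intro z w h
  have h0 := congrArg (fun M : Matrix.orthogonalGroup (Fin 2) ℝ =>
    (M : Matrix (Fin 2) (Fin 2) ℝ) 0 0) h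
  have h1 := congrArg (fun M : Matrix.orthogonalGroup (Fin 2) ℝ =>
    (M : Matrix (Fin 2) (Fin 2) ℝ) 1 0) h
  exact Circle.ext (Complex.ext h0 h1)

/-! ### Parametrized representations and the dimension formula -/

namespace AffineModel

variable {k : ℕ} (A : AffineModel k)

/-- The image of an integer vector under the lattice embedding with parameter `y`. -/
def point (y : Fin A.d → ℂ) : (Fin 2 → ℤ) →+ ℂ where
  toFun t := A.φ t ⬝ᵥ y
  map_zero' := by simp
  map_add' s t := by rw [map_add, add_dotProduct]

/-- The parameters `y` for which `ℤ²` is embedded as a lattice. -/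
def nondegenerate : Set (Fin A.d → ℂ) :=
  -- This imaginary part is the signed area of the fundamental parallelogram.
  {y | (starRingEnd ℂ (A.point y (Pi.single 0 1)) * A.point y (Pi.single 1 1)).im ≠ 0}

theorem isOpen_nondegenerate : IsOpen A.nondegenerate := by
  refine isOpen_ne_fun ?_ continuous_const
  simp only [point, AddMonoidHom.coe_mk, ZeroHom.coe_mk]
  fun_prop

variable {A} in
/-- The real linear extension of the lattice embedding is injective. -/
theorem exists_antilipschitz {y : Fin A.d → ℂ} (hy : y ∈ A.nondegenerate) :
    ∃ K : NNReal, 0 < K ∧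
      ∀ t, ‖(fun i => (t i : ℝ) : Fin 2 → ℝ)‖ ≤ K * ‖ofComplex (A.point y t)‖ := by
  let N : (Fin 2 → ℝ) →ₗ[ℝ] (Fin 2 → ℝ) := ofComplex.toLinearMap ∘ₗ
    Fintype.linearCombination ℝ ![A.point y (Pi.single 0 1), A.point y (Pi.single 1 1)]
  have hN : LinearMap.ker N = ⊥ := by
    rw [LinearMap.ker_eq_bot']
    intro x hx
    have h1 : x 0 • A.point y (Pi.single 0 1) + x 1 • A.point y (Pi.single 1 1) = 0 := by
      have := (ofComplex.map_eq_zero_iff).1 (show ofComplex _ = 0 from hx)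
      simpa [Fintype.linearCombination_apply, Fin.sum_univ_two] using this
    have hy : (starRingEnd ℂ (A.point y (Pi.single 0 1)) *
      A.point y (Pi.single 1 1)).im ≠ 0 := hy
    have h2 := congrArg Complex.re h1
    have h3 := congrArg Complex.im h1
    simp only [Complex.mul_im, Complex.conj_re, Complex.conj_im] at hy
    simp only [Complex.add_re, Complex.add_im, Complex.smul_re, Complex.smul_im, smul_eq_mul,
      Complex.zero_re, Complex.zero_im] at h2 h3
    ext i
    fin_cases i
    · refine (mul_eq_zero.1 ?_).resolve_right hy
      simp only [Fin.zero_eta]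
      linear_combination (A.point y (Pi.single 1 1)).im * h2 -
        (A.point y (Pi.single 1 1)).re * h3
    · refine (mul_eq_zero.1 ?_).resolve_right hy
      simp only [Fin.mk_one]
      linear_combination (A.point y (Pi.single 0 1)).re * h3 -
        (A.point y (Pi.single 0 1)).im * h2
  obtain ⟨K, hK0, hK⟩ := N.exists_antilipschitzWith hN
  refine ⟨K, hK0, fun t => ?_⟩
  have h1 := hK.le_mul_dist (fun i => (t i : ℝ)) 0
  rw [map_zero, dist_zero_right, dist_zero_right] at h1
  have h2 : N (fun i => (t i : ℝ)) = ofComplex (A.point y t) := by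
    change ofComplex _ = ofComplex _
    rw [map_lattice_eq (A.point y) t]
    simp [Fintype.linearCombination_apply, Fin.sum_univ_two]
  rwa [h2] at h1

/-- The representation with lattice parameter `y`. -/
def toRep (y : Fin A.d → ℂ) : CrystGroup k →* Euc2 where
  toFun γ := ⟨Multiplicative.ofAdd (ofComplex (A.transl γ ⬝ᵥ y)), circleMatrix (A.χ γ.right)⟩
  map_one' := by
    refine Euc2.ext_iff.2 ⟨?_, ?_⟩
    · change ofComplex (A.transl 1 ⬝ᵥ y) = 0
      rw [transl_one, zero_dotProduct, map_zero]
    · change (circleMatrix (A.χ 1) : Matrix (Fin 2) (Fin 2) ℝ) = 1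
      rw [map_one, circleMatrix_one]
      rfl
  map_mul' γ δ := by
    refine Euc2.ext_iff.2 ⟨?_, ?_⟩
    · rw [vec_mul]
      change ofComplex (A.transl (γ * δ) ⬝ᵥ y) = ofComplex (A.transl γ ⬝ᵥ y) +
        (circleMatrix (A.χ γ.right) : Matrix (Fin 2) (Fin 2) ℝ).mulVec
          (ofComplex (A.transl δ ⬝ᵥ y))
      rw [circleMatrix_mulVec, transl_mul, add_dotProduct, smul_dotProduct, map_add, smul_eq_mul]
    · rw [mat_mul]
      change (circleMatrix (A.χ (γ.right * δ.right)) : Matrix (Fin 2) (Fin 2) ℝ) = _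
      rw [map_mul, circleMatrix_mul]
      rfl

theorem vec_toRep (y : Fin A.d → ℂ) (γ : CrystGroup k) :
    vec (A.toRep y γ) = ofComplex (A.transl γ ⬝ᵥ y) := rfl

variable {A}

/-- The image lies in the product of a lattice, whose points are at least 1/K apart, and a finite
set of rotation matrices; faithfulness comes from injectivity of the lattice embedding and of χ. -/
theorem toRep_mem_rep [NeZero k] {y : Fin A.d → ℂ} (hy : y ∈ A.nondegenerate) :
    A.toRep y ∈ Rep k := by
  obtain ⟨K, hK0, hK⟩ := exists_antilipschitz hy
  refine ⟨?_, ?_⟩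
  · rw [injective_iff_map_eq_one]
    intro γ hγ
    have h1 : vec (A.toRep y γ) = 0 := by rw [hγ, vec_one]
    have h2 : A.toRep y γ = A.toRep y 1 := by rw [hγ, map_one]
    have h3 : circleMatrix (A.χ γ.right) = circleMatrix (A.χ 1) :=
      congrArg SemidirectProduct.right h2
    have h4 := hK γ.left.toAdd
    rw [vec_toRep] at h1
    rw [show ofComplex (A.point y γ.left.toAdd) = 0 from h1, norm_zero, mul_zero,
      norm_le_zero_iff] at h4
    refine SemidirectProduct.ext ?_ (A.χ_injective (circleMatrix_injective h3))
    refine Multiplicative.toAdd.injective (funext fun i => ?_)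
    have := congrFun h4 i
    simpa using this
  · let T : Set (Fin 2 → ℝ) := Set.range fun t => ofComplex (A.point y t)
    let M : Set (Fin 2 → Fin 2 → ℝ) := Set.range fun r : Multiplicative (ZMod k) =>
      fun i j => (circleMatrix (A.χ r) : Matrix (Fin 2) (Fin 2) ℝ) i j
    have hM : DiscreteTopology M := by
      have : Finite (Multiplicative (ZMod k)) := inferInstanceAs (Finite (ZMod k))
      have : Finite M := Set.finite_range _
      infer_instance
    have hT : DiscreteTopology T := by
      refine DiscreteTopology.of_forall_le_dist (r := 1 / K) (by positivity) ?_
      rintro ⟨_, s, rfl⟩ ⟨_, t, rfl⟩ hst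
      change 1 / (K : ℝ) ≤ dist (ofComplex (A.point y s)) (ofComplex (A.point y t))
      rw [dist_eq_norm, ← map_sub, ← map_sub, div_le_iff₀' (by positivity)]
      refine le_trans ?_ (hK (s - t))
      have hne : s ≠ t := by
        rintro rfl
        exact hst rfl
      obtain ⟨i, hi⟩ := Function.ne_iff.1 hne
      refine le_trans ?_ (norm_le_pi_norm (fun i => (((s - t) i : ℤ) : ℝ)) i)
      rw [Real.norm_eq_abs, ← Int.cast_abs]
      exact_mod_cast Int.one_le_abs (sub_ne_zero.2 hi)
    let f : (Set.range fun γ => (A.toRep y γ).coord) → T × M := fun x =>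
      (⟨x.1.1, by obtain ⟨γ, hγ⟩ := x.2; exact ⟨γ.left.toAdd, congrArg Prod.fst hγ⟩⟩,
        ⟨x.1.2, by obtain ⟨γ, hγ⟩ := x.2; exact ⟨γ.right, congrArg Prod.snd hγ⟩⟩)
    refine DiscreteTopology.of_continuous_injective (f := f) ?_ ?_
    · fun_prop
    · intro x x' h
      have h1 := congrArg (fun p => p.1.1) h
      have h2 := congrArg (fun p => p.2.1) h
      exact Subtype.ext (Prod.ext h1 h2)

/-- Every discrete faithful representation is, up to a complex conjugation, given on the lattice by
a parameter in the model. -/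
def IsUniversal (A : AffineModel k) : Prop :=
  ∀ Ψ ∈ Rep k, ∃ y : Fin A.d → ℂ,
    (∀ t, vec (Ψ (translation k t)) = ofComplex (A.point y t)) ∨
    (∀ t, vec (Ψ (translation k t)) = ofComplex (starRingEnd ℂ (A.point y t)))

/-- The matrix whose rows are the translational parts of finitely many elements. -/
def translMatrix (A : AffineModel k) {H : Subgroup (CrystGroup k)} (F : Finset H) :
    Matrix F (Fin A.d) ℂ := Matrix.of fun γ => A.transl γ.1

theorem rank_translMatrix_le (A : AffineModel k) {H : Subgroup (CrystGroup k)} (F : Finset H) :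
    (A.translMatrix F).rank ≤ Module.finrank ℂ (A.translSpan H) := by
  rw [Matrix.rank_eq_finrank_span_row]
  refine Submodule.finrank_mono (Submodule.span_mono ?_)
  rintro _ ⟨γ, rfl⟩
  exact ⟨γ.1.1, γ.1.2, rfl⟩

theorem translation_left_toAdd {γ : CrystGroup k} (h : γ ∈ translations k) :
    translation k γ.left.toAdd = γ :=
  SemidirectProduct.ext rfl (mem_translations.1 h).symm

/-- On translations the matrix part is constantly 1, and the vectors are linear in `y` or conjugate
to that. So the image lies in two smooth images of the range of `translMatrix`, a real space of
dimension at most 2 dim span φ(H). -/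
theorem dimH_le (hA : A.IsUniversal) {H : Subgroup (CrystGroup k)} (hH : H ≤ translations k)
    (F : Finset H) :
    dimH ((fun (Φ : H →* Euc2) (γ : F) => (Φ γ).coord) '' restrictedRep H) ≤
      ((2 * Module.finrank ℂ (A.translSpan H) : ℕ) : ENNReal) := by
  let S := LinearMap.range (A.translMatrix F).mulVecLin
  have hS : Module.finrank ℝ S ≤ 2 * Module.finrank ℂ (A.translSpan H) := by
    rw [finrank_real_of_complex]
    exact Nat.mul_le_mul_left 2 (rank_translMatrix_le A F)
  let f : S → (F → (Fin 2 → ℝ) × (Fin 2 → Fin 2 → ℝ)) := fun w γ =>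
    (ofComplex (w.1 γ), fun i j => (1 : Matrix (Fin 2) (Fin 2) ℝ) i j)
  let f' : S → (F → (Fin 2 → ℝ) × (Fin 2 → Fin 2 → ℝ)) := fun w γ =>
    (ofComplex (Complex.conjCLE (w.1 γ)), fun i j => (1 : Matrix (Fin 2) (Fin 2) ℝ) i j)
  have hw : ∀ γ : F, ContDiff ℝ 1 fun w : S => w.1 γ := fun γ =>
    (((ContinuousLinearMap.proj (R := ℝ) γ).comp
      ((S.restrictScalars ℝ).subtypeL)).contDiff : ContDiff ℝ 1 _)
  have hf : ContDiff ℝ 1 f := contDiff_pi.2 fun γ =>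
    (ofComplex.contDiff.comp (hw γ)).prodMk contDiff_const
  have hf' : ContDiff ℝ 1 f' := contDiff_pi.2 fun γ =>
    (ofComplex.contDiff.comp (Complex.conjCLE.contDiff.comp (hw γ))).prodMk contDiff_const
  have hsub : (fun (Φ : H →* Euc2) (γ : F) => (Φ γ).coord) '' restrictedRep H ⊆
      Set.range f ∪ Set.range f' := by
    rintro _ ⟨_, ⟨Ψ, hΨ, rfl⟩, rfl⟩
    obtain ⟨y, hy⟩ := hA Ψ hΨ
    have hmat : ∀ γ : F, mat (Ψ γ.1.1) = 1 := fun γ =>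
      mat_eq_one_of_mem_translations hΨ (hH γ.1.2)
    have hvec : ∀ γ : F, vec (Ψ γ.1.1) = vec (Ψ (translation k γ.1.1.left.toAdd)) := fun γ => by
      rw [translation_left_toAdd (hH γ.1.2)]
    rcases hy with hy | hy
    · refine Or.inl ⟨⟨_, y, rfl⟩, funext fun γ => Prod.ext ?_ ?_⟩
      · exact ((hvec γ).trans (hy _)).symm
      · exact (hmat γ).symm
    · refine Or.inr ⟨⟨_, y, rfl⟩, funext fun γ => Prod.ext ?_ ?_⟩
      · exact ((hvec γ).trans (hy _)).symm
      · exact (hmat γ).symm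
  refine (dimH_mono hsub).trans ?_
  rw [dimH_union]
  have hS' : (Module.finrank ℝ S : ENNReal) ≤
    ((2 * Module.finrank ℂ (A.translSpan H) : ℕ) : ENNReal) := by exact_mod_cast hS
  exact max_le (hf.dimH_range_le.trans hS') (hf'.dimH_range_le.trans hS')

/-- For `F` indexing a basis of the span of translational parts, the map from parameters to
coordinates is onto, hence open. The Lipschitz projection `p` of the image thus contains a nonempty
open subset of ℂ^F. -/
theorem exists_le_dimH [NeZero k] (hA : A.nondegenerate.Nonempty) (H : Subgroup (CrystGroup k)) :
    ∃ F : Finset H, ((2 * Module.finrank ℂ (A.translSpan H) : ℕ) : ENNReal) ≤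
      dimH ((fun (Φ : H →* Euc2) (γ : F) => (Φ γ).coord) '' restrictedRep H) := by
  obtain ⟨b, -, -, hb, hli⟩ := exists_linearIndepOn_extension
    (linearIndepOn_empty ℂ fun γ : H => A.transl γ) (Set.empty_subset Set.univ)
  have hbf : b.Finite := hli.finite
  let F := hbf.toFinset
  have hliF : LinearIndependent ℂ (A.translMatrix F).row := by
    have : LinearIndepOn ℂ (fun γ : H => A.transl γ) (F : Set H) := by
      rwa [Set.Finite.coe_toFinset]
    exact this
  have hrank : (A.translMatrix F).rank = Fintype.card F := hliF.rank_matrix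
  have hcard : Module.finrank ℂ (A.translSpan H) ≤ Fintype.card F := by
    rw [← hrank, Matrix.rank_eq_finrank_span_row]
    refine Submodule.finrank_mono (Submodule.span_le.2 ?_)
    rintro _ ⟨γ, hγ, rfl⟩
    refine Submodule.span_mono ?_ (hb ⟨⟨γ, hγ⟩, Set.mem_univ _, rfl⟩)
    rintro _ ⟨δ, hδ, rfl⟩
    exact ⟨⟨δ, hbf.mem_toFinset.2 hδ⟩, rfl⟩
  have hsurj : Function.Surjective (A.translMatrix F).mulVecLin := by
    rw [← LinearMap.range_eq_top]
    refine Submodule.eq_top_of_finrank_eq ?_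
    rw [Module.finrank_fintype_fun_eq_card]
    exact hrank
  have hopen := LinearMap.isOpenMap_of_finiteDimensional _ hsurj _ A.isOpen_nondegenerate
  let p : (F → (Fin 2 → ℝ) × (Fin 2 → Fin 2 → ℝ)) →L[ℝ] (F → ℂ) :=
    ContinuousLinearMap.pi fun γ => (ofComplex.symm : (Fin 2 → ℝ) →L[ℝ] ℂ).comp
      ((ContinuousLinearMap.fst ℝ _ _).comp (ContinuousLinearMap.proj γ))
  refine ⟨F, ?_⟩
  have h1 := p.lipschitz.dimH_image_le
    ((fun (Φ : H →* Euc2) (γ : F) => (Φ γ).coord) '' restrictedRep H)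
  refine le_trans ?_ h1
  have h2 : (A.translMatrix F).mulVecLin '' A.nondegenerate ⊆
      p '' ((fun (Φ : H →* Euc2) (γ : F) => (Φ γ).coord) '' restrictedRep H) := by
    rintro _ ⟨y, hy, rfl⟩
    refine ⟨_, ⟨_, ⟨A.toRep y, toRep_mem_rep hy, rfl⟩, rfl⟩, funext fun γ => ?_⟩
    exact ofComplex.symm_apply_apply _
  refine le_trans ?_ (dimH_mono h2)
  rw [Real.dimH_of_nonempty_interior (by rw [hopen.interior_eq]; exact hA.image _),
    finrank_real_of_complex, Module.finrank_fintype_fun_eq_card]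
  exact_mod_cast Nat.mul_le_mul_left 2 hcard

theorem rep_eq [NeZero k] (hA : A.IsUniversal) (hA' : A.nondegenerate.Nonempty)
    {H : Subgroup (CrystGroup k)} (hH : H ≤ translations k) :
    rep H = 2 * Module.finrank ℂ (A.translSpan H) := by
  have : (⨆ F : Finset H,
      dimH ((fun (Φ : H →* Euc2) (γ : F) => (Φ γ).coord) '' restrictedRep H)) =
      ((2 * Module.finrank ℂ (A.translSpan H) : ℕ) : ENNReal) := by
    refine le_antisymm (iSup_le fun F => dimH_le hA hH F) ?_
    obtain ⟨F, hF⟩ := exists_le_dimH hA' H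
    exact hF.trans (le_iSup (fun F : Finset H =>
      dimH ((fun (Φ : H →* Euc2) (γ : F) => (Φ γ).coord) '' restrictedRep H)) F)
  rw [rep, this, ENNReal.toReal_natCast]
  push_cast
  rfl

end AffineModel


/-! ### The models -/

theorem rotMatHom_one (k : ℕ) : rotMatHom k (Multiplicative.ofAdd 1) = (rotMatrix k).1 := by
  have h : rotHom k (Multiplicative.ofAdd 1) = rotMatrix k := by
    have := ZMod.lift_coe k (A := Additive SL(2, ℤ))
      ⟨zmultiplesHom (Additive SL(2, ℤ)) (Additive.ofMul (rotMatrix k)), by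
        rw [zmultiplesHom_apply, natCast_zsmul, ← ofMul_pow, rotMatrix_pow, ofMul_one]⟩ 1
    rw [Int.cast_one] at this
    refine Additive.ofMul.injective (Eq.trans this ?_)
    simp
  exact congrArg Subtype.val h

theorem eq_ofAdd_one_pow {k : ℕ} [NeZero k] (r : Multiplicative (ZMod k)) :
    r = Multiplicative.ofAdd 1 ^ (Multiplicative.toAdd r).val := by
  rw [← ofAdd_nsmul, nsmul_one, ZMod.natCast_zmod_val, ofAdd_toAdd]

/-- The inclusion of `ℤ/k` in the circle group. -/
def rotChar (k : ℕ) [NeZero k] : Multiplicative (ZMod k) →* Circle :=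
  (ZMod.toCircle (N := k)).toMonoidHom

theorem rotChar_injective (k : ℕ) [NeZero k] : Function.Injective (rotChar k) :=
  ZMod.injective_toCircle.comp Multiplicative.toAdd.injective

theorem map_rotMatHom_mulVec {k d : ℕ} [NeZero k] (φ : (Fin 2 → ℤ) →+ (Fin d → ℂ))
    (h : ∀ t, φ ((rotMatrix k).1.mulVec t) = (rotChar k (Multiplicative.ofAdd 1) : ℂ) • φ t)
    (r : Multiplicative (ZMod k)) (t : Fin 2 → ℤ) :
    φ ((rotMatHom k r).mulVec t) = (rotChar k r : ℂ) • φ t := by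
  rw [eq_ofAdd_one_pow r]
  induction (Multiplicative.toAdd r).val with
  | zero => simp
  | succ n ih =>
    rw [pow_succ', map_mul, map_mul, ← Matrix.mulVec_mulVec, rotMatHom_one, h, ih, Circle.coe_mul,
      mul_smul]

/-- The root of unity by which the generator of `ℤ/k` acts. -/
def rotRoot (k : ℕ) [NeZero k] : ℂ := rotChar k (Multiplicative.ofAdd 1)

theorem rotRoot_pow_ne_one {k n : ℕ} [NeZero k] (h : (n : ZMod k) ≠ 0) : rotRoot k ^ n ≠ 1 := by
  intro h1
  rw [rotRoot, ← Circle.coe_pow, ← map_pow, Circle.coe_eq_one, ← map_one (rotChar k),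
    ← ofAdd_nsmul, nsmul_one] at h1
  exact h (rotChar_injective k h1)

theorem rotRoot_pow_self (k : ℕ) [NeZero k] : rotRoot k ^ k = 1 := by
  rw [rotRoot, ← Circle.coe_pow, ← map_pow, ← ofAdd_nsmul, nsmul_one, ZMod.natCast_self, ofAdd_zero,
    map_one, Circle.coe_one]

/-- Here τ is the trace of the rotation matrix, and X² - τX + 1 is the factor of X^k - 1 that
remains once roots of smaller order are excluded. The bound on τ later shows that the root is not
real. -/
theorem exists_trace {k : ℕ} [NeZero k] (hk : k = 3 ∨ k = 4 ∨ k = 6) :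
    ∃ τ : ℤ, τ ^ 2 ≤ 1 ∧ (rotMatrix k).1 = !![0, -1; 1, τ] ∧
      rotRoot k ^ 2 = τ * rotRoot k - 1 := by
  have h0 := rotRoot_pow_self k
  rcases hk with rfl | rfl | rfl
  · refine ⟨-1, by norm_num, rfl, ?_⟩
    have h1 : rotRoot 3 ^ 1 ≠ 1 := rotRoot_pow_ne_one (by decide)
    have h2 : rotRoot 3 - 1 ≠ 0 := by rwa [pow_one, ← sub_ne_zero] at h1
    refine sub_eq_zero.1 ((mul_eq_zero.1 ?_).resolve_left h2)
    push_cast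
    linear_combination h0
  · refine ⟨0, by norm_num, rfl, ?_⟩
    have h1 : rotRoot 4 ^ 2 ≠ 1 := rotRoot_pow_ne_one (by decide)
    refine sub_eq_zero.1 ((mul_eq_zero.1 ?_).resolve_left (sub_ne_zero.2 h1))
    push_cast
    linear_combination h0
  · refine ⟨1, by norm_num, rfl, ?_⟩
    have h1 : rotRoot 6 ^ 3 ≠ 1 := rotRoot_pow_ne_one (by decide)
    have h2 : rotRoot 6 ^ 2 ≠ 1 := rotRoot_pow_ne_one (by decide)
    have h3 : rotRoot 6 + 1 ≠ 0 := fun h => h2 (by linear_combination (rotRoot 6 - 1) * h)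
    refine sub_eq_zero.1 ((mul_eq_zero.1 ((mul_eq_zero.1 ?_).resolve_left
      (sub_ne_zero.2 h1))).resolve_left h3)
    push_cast
    linear_combination h0

/-- The translation vectors by which the translations of `Γ_k` act in a representation. -/
def latticeHom {k : ℕ} {Ψ : CrystGroup k →* Euc2} (hΨ : Ψ ∈ Rep k) :
    (Fin 2 → ℤ) →+ (Fin 2 → ℝ) :=
  AddMonoidHom.mk' (fun t => vec (Ψ (translation k t))) fun s t => by
    rw [translation_add, map_mul, vec_mul,
      mat_eq_one_of_mem_translations hΨ (translation_mem k s), Matrix.one_mulVec]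

/-- The inclusion of `ℤ²` in `ℂ²`. -/
def latticeInclusion : (Fin 2 → ℤ) →+ (Fin 2 → ℂ) where
  toFun t i := t i
  map_zero' := by ext; simp
  map_add' s t := by ext; simp

theorem latticeInclusion_mulVec {k : ℕ} [NeZero k] (hk : k = 2) (t : Fin 2 → ℤ) :
    latticeInclusion ((rotMatrix k).1.mulVec t) = rotRoot k • latticeInclusion t := by
  have h1 : rotRoot k ^ 1 ≠ 1 := rotRoot_pow_ne_one (by subst hk; decide)
  have h2 : rotRoot k = -1 := by
    rw [pow_one] at h1
    have h3 := rotRoot_pow_self k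
    rw [show rotRoot k ^ k = rotRoot k ^ 2 from congrArg _ hk, pow_two] at h3
    exact (mul_self_eq_one_iff.1 h3).resolve_left h1
  have h3 : (rotMatrix k).1 = !![-1, 0; 0, -1] := by
    subst hk
    rfl
  rw [h2, h3]
  ext i
  fin_cases i <;> simp [latticeInclusion, dotProduct, Fin.sum_univ_two]

/-- The model of `Γ_2`. -/
def affineModelTwo {k : ℕ} [NeZero k] (hk : k = 2) : AffineModel k where
  d := 2
  φ := latticeInclusion
  χ := rotChar k
  χ_injective := rotChar_injective k
  φ_mulVec := map_rotMatHom_mulVec latticeInclusion (latticeInclusion_mulVec hk)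
  span_φ := by
    rw [← top_le_iff, ← (Pi.basisFun ℂ (Fin 2)).span_eq, Submodule.span_le]
    rintro _ ⟨i, rfl⟩
    refine Submodule.subset_span ⟨Pi.single i 1, ?_⟩
    ext j
    fin_cases i <;> fin_cases j <;> simp [latticeInclusion]

/-- Any two vectors can be the images of the lattice generators, so two free complex parameters
suffice and no conjugate is needed. -/
theorem affineModelTwo_isUniversal {k : ℕ} [NeZero k] (hk : k = 2) :
    (affineModelTwo hk).IsUniversal := by
  intro Ψ hΨ
  let y : Fin 2 → ℂ := fun i => ofComplex.symm (latticeHom hΨ (Pi.single i 1))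
  refine ⟨y, Or.inl fun t => ?_⟩
  change latticeHom hΨ t = _
  rw [map_lattice_eq, map_lattice_eq ((affineModelTwo hk).point y), map_add, map_zsmul, map_zsmul]
  have h : ∀ i, ofComplex ((affineModelTwo hk).point y (Pi.single i 1)) =
      latticeHom hΨ (Pi.single i 1) := by
    intro i
    have : (affineModelTwo hk).point y (Pi.single i 1) = y i := by
      change ∑ j : Fin 2, (((Pi.single i 1 : Fin 2 → ℤ) j : ℤ) : ℂ) * y j = y i
      fin_cases i <;> simp [Fin.sum_univ_two]
    rw [this]
    exact ofComplex.apply_symm_apply _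
  rw [h, h]

theorem affineModelTwo_nondegenerate {k : ℕ} [NeZero k] (hk : k = 2) :
    (affineModelTwo hk).nondegenerate.Nonempty := by
  refine ⟨(![1, Complex.I] : Fin 2 → ℂ), ?_⟩
  change (starRingEnd ℂ (∑ j : Fin 2, (((Pi.single 0 1 : Fin 2 → ℤ) j : ℤ) : ℂ) *
    (![1, Complex.I] : Fin 2 → ℂ) j) * (∑ j : Fin 2, (((Pi.single 1 1 : Fin 2 → ℤ) j : ℤ) : ℂ) *
    (![1, Complex.I] : Fin 2 → ℂ) j)).im ≠ 0
  simp [Fin.sum_univ_two]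

/-- The model of `Γ_k` for `k = 3, 4, 6`. -/
def affineModelOne {k : ℕ} [NeZero k] (hk : k = 3 ∨ k = 4 ∨ k = 6) : AffineModel k where
  d := 1
  φ :=
    { toFun := fun t _ => t 0 + t 1 * rotRoot k
      map_zero' := by ext; simp
      map_add' := fun s t => by ext; simp; ring }
  χ := rotChar k
  χ_injective := rotChar_injective k
  φ_mulVec := map_rotMatHom_mulVec _ fun t => by
    obtain ⟨τ, -, h1, h2⟩ := exists_trace hk
    change _ = rotRoot k • _
    rw [h1]
    ext i
    simp only [AddMonoidHom.coe_mk, ZeroHom.coe_mk, Matrix.mulVec, dotProduct, Fin.sum_univ_two,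
      Matrix.of_apply, Matrix.cons_val_zero, Matrix.cons_val_one, Pi.smul_apply, smul_eq_mul]
    push_cast
    linear_combination -(t 1 : ℂ) * h2
  span_φ := by
    rw [← top_le_iff, ← (Pi.basisFun ℂ (Fin 1)).span_eq, Submodule.span_le]
    rintro _ ⟨i, rfl⟩
    refine Submodule.subset_span ⟨Pi.single 0 1, ?_⟩
    ext j
    fin_cases i
    fin_cases j
    simp

theorem affineModelOne_point {k : ℕ} [NeZero k] (hk : k = 3 ∨ k = 4 ∨ k = 6) (y : ℂ)
    (t : Fin 2 → ℤ) :
    (affineModelOne hk).point (fun _ => y) t = (t 0 + t 1 * rotRoot k) * y := by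
  change ∑ j : Fin 1, (t 0 + t 1 * rotRoot k) * y = _
  simp

/-- The orthogonal part Q of the rotation generator acts on the lattice generators by v ↦ w ↦ τw -
v. As Q is an isometry, w read as a complex number is v times the root of unity or its conjugate;
the second case needs the conjugate parametrization. -/
theorem affineModelOne_isUniversal {k : ℕ} [NeZero k] (hk : k = 3 ∨ k = 4 ∨ k = 6) :
    (affineModelOne hk).IsUniversal := by
  intro Ψ hΨ
  obtain ⟨τ, hτ, hR, hζ⟩ := exists_trace hk
  let ρ : CrystGroup k := SemidirectProduct.inr (Multiplicative.ofAdd 1)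
  set Q := mat (Ψ ρ) with hQ
  have hconj : ∀ t, Q.mulVec (latticeHom hΨ t) = latticeHom hΨ ((rotMatrix k).1.mulVec t) := by
    intro t
    have h1 : ρ * translation k t = translation k ((rotMatrix k).1.mulVec t) * ρ := by
      rw [← rotMatHom_one]
      change _ = SemidirectProduct.inl (mulVecAut (rotMatHom k) (Multiplicative.ofAdd 1)
        (Multiplicative.ofAdd t)) * ρ
      rw [SemidirectProduct.inl_aut, map_inv, inv_mul_cancel_right]
      rfl
    have h2 := congrArg (fun γ => vec (Ψ γ)) h1
    simp only [map_mul, vec_mul, mat_eq_one_of_mem_translations hΨ (translation_mem k _),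
      Matrix.one_mulVec] at h2
    rw [add_comm] at h2
    exact add_right_cancel h2
  set v := latticeHom hΨ (Pi.single 0 1) with hv
  set w := latticeHom hΨ (Pi.single 1 1) with hw
  have hw1 : Q.mulVec v = w := by
    rw [hv, hconj, hR, hw]
    congr 1
    ext i
    fin_cases i <;> simp
  have hw2 : Q.mulVec w = (τ : ℝ) • w - v := by
    rw [hw, hconj, hR, map_lattice_eq]
    simp [← hv, ← hw, Matrix.mulVec, dotProduct, Fin.sum_univ_two]
    ext i
    simp
    ring
  have hdot : ∀ x z, Q.mulVec x ⬝ᵥ Q.mulVec z = x ⬝ᵥ z := fun x z => by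
    rw [Matrix.dotProduct_mulVec, ← Matrix.mulVec_transpose, Matrix.mulVec_mulVec,
      transpose_mul_mat, Matrix.one_mulVec]
  have e1 := hdot v v
  have e2 := hdot w v
  rw [hw1] at e1
  rw [hw2, hw1] at e2
  simp only [dotProduct, Fin.sum_univ_two, Pi.sub_apply, Pi.smul_apply, smul_eq_mul] at e1 e2
  let z : ℂ := ⟨v 0, v 1⟩
  let s : ℂ := ⟨w 0, w 1⟩
  have hz : ofComplex z = v := by
    rw [ofComplex_apply]
    ext i
    fin_cases i <;> rfl
  have hs : ofComplex s = w := by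
    rw [ofComplex_apply]
    ext i
    fin_cases i <;> rfl
  -- This is s² - τsz + z² = 0; it follows from |s| = |z| and 2 Re(s z̄) = τ|z|² after
  -- multiplication by z̄².
  have hquad : (s - rotRoot k * z) * (s - starRingEnd ℂ (rotRoot k) * z) = 0 := by
    have hn : rotRoot k * starRingEnd ℂ (rotRoot k) = 1 := by
      rw [Complex.mul_conj, rotRoot, Circle.normSq_coe, Complex.ofReal_one]
    have ht : rotRoot k + starRingEnd ℂ (rotRoot k) = τ := by
      linear_combination starRingEnd ℂ (rotRoot k) * hζ + (τ - rotRoot k) * hn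
    have h1 : s * starRingEnd ℂ s = z * starRingEnd ℂ z := by
      rw [Complex.mul_conj, Complex.mul_conj, Complex.normSq_apply, Complex.normSq_apply, e1]
    have h2 : s * starRingEnd ℂ z + starRingEnd ℂ s * z = τ * (z * starRingEnd ℂ z) := by
      apply Complex.ext
      · simp [z, s]
        linear_combination -e2 + (τ : ℝ) * e1
      · simp [z, s]
        ring
    by_cases hz0 : z = 0
    · rw [hz0, zero_mul, Complex.mul_conj, Complex.ofReal_eq_zero, Complex.normSq_eq_zero] at h1
      rw [hz0, h1]
      simp
    · have h3 : starRingEnd ℂ z ^ 2 ≠ 0 :=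
        pow_ne_zero 2 ((map_ne_zero_iff _ (RingHom.injective _)).2 hz0)
      refine (mul_eq_zero.1 ?_).resolve_left h3
      linear_combination s * starRingEnd ℂ z * h2 - z * starRingEnd ℂ z * h1 -
        starRingEnd ℂ z ^ 2 * z * s * ht + starRingEnd ℂ z ^ 2 * z ^ 2 * hn
  have hlat : ∀ t, vec (Ψ (translation k t)) = ofComplex (t 0 * z + t 1 * s) := by
    intro t
    change latticeHom hΨ t = _
    rw [map_lattice_eq, ← hv, ← hw, ← hz, ← hs, ← zsmul_eq_mul, ← zsmul_eq_mul, map_add,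
      map_zsmul, map_zsmul]
  rcases mul_eq_zero.1 hquad with h | h
  · refine ⟨fun _ => z, Or.inl fun t => ?_⟩
    rw [hlat, affineModelOne_point, sub_eq_zero.1 h]
    congr 1
    ring
  · refine ⟨fun _ => starRingEnd ℂ z, Or.inr fun t => ?_⟩
    rw [hlat, affineModelOne_point, sub_eq_zero.1 h]
    congr 1
    simp
    ring

theorem affineModelOne_nondegenerate {k : ℕ} [NeZero k] (hk : k = 3 ∨ k = 4 ∨ k = 6) :
    (affineModelOne hk).nondegenerate.Nonempty := by
  obtain ⟨τ, hτ, -, hζ⟩ := exists_trace hk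
  refine ⟨fun _ => 1, ?_⟩
  change Complex.im _ ≠ 0
  rw [affineModelOne_point, affineModelOne_point]
  have h : (rotRoot k).im ≠ 0 := by
    intro h
    have h1 := congrArg Complex.re hζ
    have h2 : ((τ : ℝ)) ^ 2 ≤ 1 := by exact_mod_cast hτ
    simp [pow_two, h] at h1
    -- A real root of X² - τX + 1 would need τ² ≥ 4.
    nlinarith [sq_nonneg ((rotRoot k).re - τ / 2)]
  simpa using h

theorem exists_affineModel {k : ℕ} (hk : k = 2 ∨ k = 3 ∨ k = 4 ∨ k = 6) :
    ∃ A : AffineModel k, ∀ H ≤ translations k, rep H = 2 * Module.finrank ℂ (A.translSpan H) := by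
  have : NeZero k := ⟨by rintro rfl; simp at hk⟩
  rcases hk with hk | hk
  · exact ⟨affineModelTwo hk, fun H hH =>
      AffineModel.rep_eq (affineModelTwo_isUniversal hk) (affineModelTwo_nondegenerate hk) hH⟩
  · exact ⟨affineModelOne hk, fun H hH =>
      AffineModel.rep_eq (affineModelOne_isUniversal hk) (affineModelOne_nondegenerate hk) hH⟩


/-! ### Linear matroids -/

section LinearMatroid

variable {α M : Type*} [AddCommGroup M] [Module ℂ M] {v : α → M}

theorem span_image_eq_of_maximal {I X : Set α} (hIX : I ⊆ X) (hI : LinearIndepOn ℂ v I)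
    (hmax : ∀ x ∈ X, LinearIndepOn ℂ v (insert x I) → x ∈ I) :
    Submodule.span ℂ (v '' I) = Submodule.span ℂ (v '' X) := by
  refine le_antisymm (Submodule.span_mono (Set.image_mono hIX)) (Submodule.span_le.2 ?_)
  rintro _ ⟨x, hx, rfl⟩
  by_contra h
  exact h (Submodule.subset_span ⟨x, hmax x hx (hI.insert h), rfl⟩)

theorem mem_of_linearIndepOn_insert {I : Set α} {x : α}
    (hx : v x ∈ Submodule.span ℂ (v '' I)) (h : LinearIndepOn ℂ v (insert x I)) : x ∈ I := by
  by_contra hxI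
  exact ((linearIndepOn_insert hxI).1 h).2 hx

/-- The matroid of linear independence of a family of vectors. -/
theorem exists_linearMatroid [FiniteDimensional ℂ M] (v : α → M) :
    ∃ N : Matroid α, N.E = Set.univ ∧ ∀ I, N.Indep I ↔ LinearIndepOn ℂ v I := by
  refine ⟨(IndepMatroid.ofBdd Set.univ (LinearIndepOn ℂ v) (linearIndepOn_empty ℂ v)
    (fun I J hJ hIJ => hJ.mono hIJ) ?_ (fun I _ => Set.subset_univ I)
    ⟨Module.finrank ℂ M, fun I hI => ?_⟩).matroid, rfl, fun I => Iff.rfl⟩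
  · intro I B hI hImax hB
    -- If no element of B extends I, then I spans B and hence everything, so I is already maximal.
    by_contra! h
    refine hImax ⟨hI, fun J hJ hIJ x hx => mem_of_linearIndepOn_insert ?_
      (hJ.mono (Set.insert_subset hx hIJ))⟩
    have h1 : Submodule.span ℂ (v '' B) = Submodule.span ℂ (v '' Set.univ) :=
      span_image_eq_of_maximal (Set.subset_univ _) hB.prop fun y _ hy =>
        hB.le_of_ge hy (Set.subset_insert _ _) (Set.mem_insert _ _)
    have h2 : Submodule.span ℂ (v '' I) = Submodule.span ℂ (v '' (I ∪ B)) := by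
      refine span_image_eq_of_maximal Set.subset_union_left hI fun y hy hyI => ?_
      by_contra hy'
      exact h y ⟨hy.resolve_left hy', hy'⟩ hyI
    rw [h2]
    have h3 : v x ∈ Submodule.span ℂ (v '' B) := h1 ▸ Submodule.subset_span ⟨x, trivial, rfl⟩
    exact Submodule.span_mono (Set.image_mono Set.subset_union_right) h3
  · have hfin : I.Finite := LinearIndependent.finite hI
    have : Fintype I := hfin.fintype
    have h1 := LinearIndependent.fintype_card_le_finrank hI
    rw [Set.encard_eq_coe_toFinset_card, Set.toFinset_card]
    exact_mod_cast h1

theorem eRk_eq_finrank [FiniteDimensional ℂ M] {N : Matroid α} (hE : N.E = Set.univ)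
    (hN : ∀ I, N.Indep I ↔ LinearIndepOn ℂ v I) (X : Set α) :
    N.eRk X = Module.finrank ℂ (Submodule.span ℂ (v '' X)) := by
  obtain ⟨I, hI⟩ := N.exists_isBasis X (by rw [hE]; exact Set.subset_univ X)
  have hli := (hN I).1 hI.indep
  have hspan : Submodule.span ℂ (v '' I) = Submodule.span ℂ (v '' X) :=
    span_image_eq_of_maximal hI.subset hli fun x hx h =>
      hI.mem_of_insert_indep hx ((hN _).2 h)
  have hfin : I.Finite := LinearIndependent.finite hli
  have : Fintype I := hfin.fintype
  have h1 := finrank_span_eq_card (R := ℂ) hli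
  rw [← Set.image_eq_range, hspan] at h1
  rw [hI.eRk_eq_encard, h1, Set.encard_eq_coe_toFinset_card, Set.toFinset_card]

theorem isBase_iff {N : Matroid α} (hN : ∀ I, N.Indep I ↔ LinearIndepOn ℂ v I)
    (hv : Submodule.span ℂ (Set.range v) = ⊤) (X : Set α) :
    N.IsBase X ↔ LinearIndepOn ℂ v X ∧ Submodule.span ℂ (v '' X) = ⊤ := by
  rw [Matroid.isBase_iff_maximal_indep]
  constructor
  · intro h
    have hX := (hN X).1 h.prop
    refine ⟨hX, ?_⟩
    rw [span_image_eq_of_maximal (Set.subset_univ X) hX, Set.image_univ, hv]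
    exact fun y _ hy => h.le_of_ge ((hN _).2 hy) (Set.subset_insert _ _) (Set.mem_insert _ _)
  · rintro ⟨hX, hspan⟩
    refine ⟨(hN X).2 hX, fun J hJ hXJ x hx => mem_of_linearIndepOn_insert (v := v) ?_
      (((hN J).1 hJ).mono (Set.insert_subset hx hXJ))⟩
    rw [hspan]
    exact Submodule.mem_top

end LinearMatroid

/-! ### The matroid of `Γ`-`(1,1)` graphs -/

open ColoredGraph AffineModel

section

variable {k : ℕ} {V E : Type*} [Fintype V] {A : AffineModel k}

theorem translSpan_translations (A : AffineModel k) : A.translSpan (translations k) = ⊤ := by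
  rw [← top_le_iff, ← A.span_φ, Submodule.span_le]
  rintro _ ⟨t, rfl⟩
  exact Submodule.subset_span ⟨translation k t, translation_mem k t, rfl⟩

theorem rep_translations
    (hA : ∀ H ≤ translations k, rep H = 2 * Module.finrank ℂ (A.translSpan H)) :
    rep (translations k) = 2 * A.d := by
  rw [hA _ le_rfl, translSpan_translations, finrank_top, Module.finrank_fintype_fun_eq_card,
    Fintype.card_fin]

theorem finsum_T {G : ColoredGraph k V E} (B : G.BaseVertices) :
    (∑ᶠ c : G.Component, T (G.rhoImage (B.vertex c))) =
      2 * Nat.card {c // ¬ HasRotation (G.rhoImage (B.vertex c))} := by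
  classical
  have : Fintype G.Component := Fintype.ofFinite _
  rw [finsum_eq_sum_of_fintype]
  simp only [T]
  rw [Finset.sum_ite, Finset.sum_const_zero, zero_add, Finset.sum_const, nsmul_eq_mul,
    Nat.card_eq_fintype_card, Fintype.card_subtype, mul_comm]

theorem finrank_span_row_eq_g [DecidableEq V]
    (hA : ∀ H ≤ translations k, rep H = 2 * Module.finrank ℂ (A.translSpan H))
    {G : ColoredGraph k V E} (B : G.BaseVertices) :
    (Module.finrank ℂ (Submodule.span ℂ (Set.range (A.row G))) : ℝ) = g B := by
  have h : (Module.finrank ℂ (Submodule.span ℂ (Set.range (A.row G))) : ℝ) +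
      Nat.card {c // ¬ HasRotation (G.rhoImage (B.vertex c))} =
      Fintype.card V + Module.finrank ℂ (A.translSpan (transGroup B)) := by
    exact_mod_cast finrank_span_row B
  rw [g, finsum_T, hA _ (transGroup_le_translations B)]
  linear_combination h

/-- Full rank n + d means exactly that every component has a rotation and Λ(G, B) has full `rep`.
The map-graph condition supplies the edge count n + d, and conversely is extracted from a basis. -/
theorem isGamma11_iff [DecidableEq V]
    (hA : ∀ H ≤ translations k, rep H = 2 * Module.finrank ℂ (A.translSpan H))
    {G : ColoredGraph k V E} (B : G.BaseVertices) :
    IsGamma11 B ↔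
      LinearIndependent ℂ (A.row G) ∧ Submodule.span ℂ (Set.range (A.row G)) = ⊤ := by
  classical
  have hrank := finrank_span_row (A := A) B
  have hd : Module.finrank ℂ (A.translSpan (transGroup B)) ≤ A.d := by
    have := Submodule.finrank_le (A.translSpan (transGroup B))
    rwa [Module.finrank_fintype_fun_eq_card, Fintype.card_fin] at this
  have hM : Module.finrank ℂ ((V → ℂ) × (Fin A.d → ℂ)) = Fintype.card V + A.d := by
    rw [Module.finrank_prod, Module.finrank_fintype_fun_eq_card,
      Module.finrank_fintype_fun_eq_card, Fintype.card_fin]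
  have hrep : rep (transGroup B) = rep (translations k) ↔
      Module.finrank ℂ (A.translSpan (transGroup B)) = A.d := by
    rw [rep_translations hA, hA _ (transGroup_le_translations B),
      mul_right_inj' (two_ne_zero' ℝ), Nat.cast_inj]
  rw [IsGamma11, hrep]
  constructor
  · rintro ⟨⟨S, hS, hSf, hSc⟩, hrot, hrep⟩
    have hempty : IsEmpty {c // ¬ HasRotation (G.rhoImage (B.vertex c))} :=
      ⟨fun c => c.2 (hrot c.1)⟩
    rw [Nat.card_of_isEmpty, hrep, add_zero, ← hM] at hrank
    have hspan := Submodule.eq_top_of_finrank_eq hrank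
    obtain ⟨hfin, hcard⟩ := hS.card_eq
    have hE : Finite E := Set.finite_univ_iff.1 (by
      rw [← Set.union_compl_self S]
      exact (Set.toFinite S).union hSf)
    have : Fintype E := Fintype.ofFinite E
    have h1 : Sᶜ.ncard = A.d := by
      rw [rep_translations hA, mul_div_cancel_left₀ _ two_ne_zero] at hSc
      exact_mod_cast hSc
    have h2 := Set.ncard_add_ncard_compl S
    rw [← Nat.card_coe_set_eq, hcard, h1, ← hM, Nat.card_eq_fintype_card] at h2
    exact ⟨linearIndependent_of_top_le_span_of_card_eq_finrank hspan.ge h2.symm, hspan⟩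
  · rintro ⟨hli, hspan⟩
    have hE : Finite E := hli.finite
    have : Fintype E := Fintype.ofFinite E
    have hcard := finrank_span_eq_card hli
    rw [hspan, finrank_top, hM] at hcard hrank
    have hcard0 : Nat.card {c // ¬ HasRotation (G.rhoImage (B.vertex c))} = 0 := by omega
    refine ⟨?_, fun c => ?_, by omega⟩
    · let a : E → ℂ := fun e => A.χ (G.color e).right
      -- The rows span, so their projections to ℂ^V do as well; `S` selects a basis of ℂ^V among
      -- these projections.
      obtain ⟨S, -, -, hS, hSli⟩ := exists_linearIndepOn_extension
        (linearIndepOn_empty ℂ (G.gainRow a)) (Set.empty_subset Set.univ)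
      have hSspan : Submodule.span ℂ (Set.range fun e : S => G.gainRow a e) = ⊤ := by
        rw [← Set.image_eq_range, ← top_le_iff]
        have h1 : Submodule.map (LinearMap.fst ℂ (V → ℂ) (Fin A.d → ℂ)) ⊤ = ⊤ := by
          rw [Submodule.map_top, LinearMap.range_eq_top]
          exact LinearMap.fst_surjective
        rw [← h1, ← hspan, Submodule.map_span, Submodule.span_le]
        rintro _ ⟨_, ⟨e, rfl⟩, rfl⟩
        exact hS ⟨e, trivial, rfl⟩
      have hScard : S.ncard = Fintype.card V := by
        have : Fintype S := Fintype.ofFinite S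
        have h1 := finrank_span_eq_card (R := ℂ) (LinearIndepOn.linearIndependent hSli)
        rw [hSspan, finrank_top, Module.finrank_fintype_fun_eq_card] at h1
        rw [← Nat.card_coe_set_eq, Nat.card_eq_fintype_card, ← h1]
      refine ⟨S, isMapGraph_of_gainRow (G := G.restrict S) (fun e => a e) hSli hSspan,
        Set.toFinite _, ?_⟩
      rw [rep_translations hA, mul_div_cancel_left₀ _ two_ne_zero]
      have h2 := Set.ncard_add_ncard_compl S
      rw [Nat.card_eq_fintype_card] at h2
      have : Sᶜ.ncard = A.d := by omega
      rw [this]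
    · by_contra hc
      have : Nonempty {c // ¬ HasRotation (G.rhoImage (B.vertex c))} := ⟨⟨c, hc⟩⟩
      exact Nat.card_pos.ne' hcard0

end

theorem exists_χ_ne_one {k : ℕ} (hk : k = 2 ∨ k = 3 ∨ k = 4 ∨ k = 6) (A : AffineModel k) :
    ∃ r, (A.χ r : ℂ) ≠ 1 := by
  have : Fact (1 < k) := ⟨by omega⟩
  refine ⟨Multiplicative.ofAdd 1, ?_⟩
  rw [Ne, Circle.coe_eq_one, ← map_one A.χ]
  exact fun h => one_ne_zero (α := ZMod k) (A.χ_injective h)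

/-- Self-loops suffice: a loop at `v` colored by a pure rotation yields a nonzero multiple of the
unit vector of `v`, and a loop colored by a translation t yields -φ(t). -/
theorem span_row_completeGraph {k : ℕ} (hk : k = 2 ∨ k = 3 ∨ k = 4 ∨ k = 6) (A : AffineModel k)
    (V : Type*) [Fintype V] [DecidableEq V] [Nonempty V] :
    Submodule.span ℂ (Set.range (A.row (completeGraph k V))) = ⊤ := by
  obtain ⟨r, hr⟩ := exists_χ_ne_one hk A
  set S := Submodule.span ℂ (Set.range (A.row (completeGraph k V)))
  have hmem : ∀ e, A.row (completeGraph k V) e ∈ S := fun e => Submodule.subset_span ⟨e, rfl⟩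
  have h1 : ∀ v, ((Pi.single v 1, 0) : (V → ℂ) × (Fin A.d → ℂ)) ∈ S := by
    intro v
    have h := S.smul_mem (1 - (A.χ r : ℂ))⁻¹ (hmem (v, v, SemidirectProduct.inr r))
    convert h
    · have hr' : 1 - (A.χ r : ℂ) ≠ 0 := sub_ne_zero.2 hr.symm
      have : (A.row (completeGraph k V) (v, v, SemidirectProduct.inr r)).1 =
          (1 - (A.χ r : ℂ)) • Pi.single v 1 := by
        rw [sub_smul, one_smul]
        rfl
      rw [Prod.smul_fst, this, smul_smul, inv_mul_cancel₀ hr', one_smul]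
    · change 0 = (1 - (A.χ r : ℂ))⁻¹ • -A.φ 0
      simp
  have h2 : ∀ t, ((0, A.φ t) : (V → ℂ) × (Fin A.d → ℂ)) ∈ S := by
    intro t
    obtain ⟨v⟩ := ‹Nonempty V›
    have h := S.neg_mem (hmem (v, v, translation k t))
    convert h
    · have : (completeGraph k V).gainRow (fun e => (A.χ ((completeGraph k V).color e).right : ℂ))
          (v, v, translation k t) = Pi.single v 1 - (A.χ 1 : ℂ) • Pi.single v 1 := rfl
      change 0 = -(completeGraph k V).gainRow _ _
      rw [this]
      simp
    · exact (neg_neg _).symm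
  have h3 : LinearMap.range (LinearMap.inl ℂ (V → ℂ) (Fin A.d → ℂ)) ≤ S := by
    rw [← Submodule.map_top, ← (Pi.basisFun ℂ V).span_eq, Submodule.map_span, Submodule.span_le]
    rintro _ ⟨_, ⟨v, rfl⟩, rfl⟩
    rw [Pi.basisFun_apply]
    exact h1 v
  have h4 : LinearMap.range (LinearMap.inr ℂ (V → ℂ) (Fin A.d → ℂ)) ≤ S := by
    rw [← Submodule.map_top, ← A.span_φ, Submodule.map_span, Submodule.span_le]
    rintro _ ⟨_, ⟨t, rfl⟩, rfl⟩
    exact h2 t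
  rw [← top_le_iff, ← LinearMap.sup_range_inl_inr]
  exact sup_le h3 h4

end Crystal

end

/-! ### The main theorem -/

theorem mainTheorem6 (k : ℕ) (hk : k = 2 ∨ k = 3 ∨ k = 4 ∨ k = 6)
    (V : Type*) [Fintype V] [Nonempty V] :
    ∃ M : Matroid (V × V × Crystal.CrystGroup k), M.E = Set.univ ∧
      ∀ B : ∀ X : Set (V × V × Crystal.CrystGroup k),
          ((Crystal.completeGraph k V).restrict X).BaseVertices,
        (∀ X, M.IsBase X ↔ Crystal.ColoredGraph.IsGamma11 (B X)) ∧
        (∀ X, ∃ r : ℕ, M.eRk X = r ∧ (r : ℝ) = Crystal.ColoredGraph.g (B X)) ∧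
        (∀ X, 0 ≤ Crystal.ColoredGraph.g (B X)) ∧
        (∀ X Y, Crystal.ColoredGraph.g (B (X ∪ Y)) + Crystal.ColoredGraph.g (B (X ∩ Y)) ≤
          Crystal.ColoredGraph.g (B X) + Crystal.ColoredGraph.g (B Y)) ∧
        (∀ X Y, X ⊆ Y → Crystal.ColoredGraph.g (B X) ≤ Crystal.ColoredGraph.g (B Y)) := by
  classical
  obtain ⟨A, hA⟩ := Crystal.exists_affineModel hk
  let v := A.row (Crystal.completeGraph k V)
  -- The rows do not involve base vertices, so one matroid serves every choice of them.
  obtain ⟨M, hE, hM⟩ := Crystal.exists_linearMatroid v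
  refine ⟨M, hE, fun B => ?_⟩
  have hrow : ∀ X : Set (V × V × Crystal.CrystGroup k),
      Set.range (A.row ((Crystal.completeGraph k V).restrict X)) = v '' X := fun X =>
    (Set.image_eq_range v X).symm
  have hg : ∀ X, ((Module.finrank ℂ (Submodule.span ℂ (v '' X)) : ℕ) : ℝ) =
      Crystal.ColoredGraph.g (B X) := fun X => by
    rw [← hrow, Crystal.finrank_span_row_eq_g hA]
  have hrk := Crystal.eRk_eq_finrank hE hM
  refine ⟨fun X => ?_, fun X => ⟨_, hrk X, hg X⟩, fun X => ?_, fun X Y => ?_, fun X Y hXY => ?_⟩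
  · rw [Crystal.isBase_iff hM (Crystal.span_row_completeGraph hk A V), Crystal.isGamma11_iff hA,
      hrow]
    rfl
  · rw [← hg]
    positivity
  · have h := M.eRk_inter_add_eRk_union_le X Y
    rw [hrk, hrk, hrk, hrk, add_comm] at h
    rw [← hg, ← hg, ← hg, ← hg]
    exact_mod_cast h
  · have h := M.eRk_mono hXY
    rw [hrk, hrk] at h
    rw [← hg, ← hg]
    exact_mod_cast h
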